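/- Let $\mathfrak{o}$ be a complete discrete valuation ring with maximal ideal $\wp$ and finite residue field of odd characteristic and cardinality $q$. Let $\mathfrak{O}$ be an unramified quadratic extension of $\mathfrak{o}$, that is, a discrete valuation ring that is finite of rank $2$ over $\mathfrak{o}$ and whose maximal ideal is $\mathfrak{P}=\wp\mathfrak{O}$, and let $x\mapsto x^\circ$ be the non-trivial automorphism of $\mathfrak{O}$ over $\mathfrak{o}$. For an integer $\ell\ge 1$ put $\mathfrak{o}_\ell=\mathfrak{o}/\wp^\ell$ and $\mathfrak{O}_\ell=\mathfrak{O}/\mathfrak{P}^\ell$, with the induced automorphism $x\mapsto x^\circ$ of $\mathfrak{O}_\ell$. For a $2\times 2$ matrix $A=(a_{ij})$ over $\mathfrak{O}_\ell$ let $A^\star=W(a_{ji}^\circ)W^{-1}$, where $W=\begin{pmatrix}0&1\\1&0\end{pmatrix}$, and let $$\mathrm{GU}_2(\mathfrak{o}_\ell)=\{A\in \mathrm{GL}_2(\mathfrak{O}_\ell) : A^\star A=\mathrm{I}_2\}.$$ An element $g$ of a group $G$ is called real if it is conjugate in $G$ to $g^{-1}$, and strongly real if $tgt^{-1}=g^{-1}$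 for some $t\in G$ of order $2$. An element of $\mathrm{GL}_2(\mathfrak{o}_\ell)$ or of $\mathrm{GU}_2(\mathfrak{o}_\ell)$ is called regular if the minimal polynomial of its reduction modulo the maximal ideal (a matrix over the residue field of $\mathfrak{o}$, respectively of $\mathfrak{O}$) equals the characteristic polynomial of that reduction. A conjugacy class is called real, strongly real or regular if it contains an element with that property, and non-regular if it is not regular. Then the following statements hold. 1. The numbers of real regular and of real non-regular classes of $\mathrm{GU}_2(\mathfrak{o}_\ell)$ coincide with those of $\mathrm{GL}_2(\mathfrak{o}_\ell)$. Hence the two groups have the same total number of real classes, which is $1+q^\ell+2\sum_{i=0}^{\ell-1}q^i$. 2. In $\mathrm{GU}_2(\mathfrak{o}_\ell)$ the number of strongly real classes equals the number of real regular classes; that is, it equals $q^\ell+1$. 3. In each of the groups $\mathrm{GL}_2(\mathfrak{o}_\ell)$ and $\mathrm{GU}_2(\mathfrak{o}_\ell)$ the number of real regular classes is $q^\ell+1$, and the number of real non-regular classes is $2\sum_{i=0}^{\ell-1}q^i$. -/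

import Mathlib

open Matrix IsLocalRing

/-! ### Real and strongly real elements and conjugacy classes -/

/-- An element of a group is real if it is conjugate to its inverse. -/
def IsRealElement {G : Type*} [Group G] (g : G) : Prop :=
  ∃ t : G, t * g * t⁻¹ = g⁻¹

/-- An element of a group is strongly real if it is conjugate to its inverse by an involution,
that is, by an element of order two. -/
def IsStronglyRealElement {G : Type*} [Group G] (g : G) : Prop :=
  ∃ t : G, orderOf t = 2 ∧ t * g * t⁻¹ = g⁻¹

/-- The conjugacy classes that contain an element satisfying `P`. -/
def classesContaining {G : Type*} [Group G] (P : G → Prop) : Set (ConjClasses G) :=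
  {c | ∃ g : G, ConjClasses.mk g = c ∧ P g}

/-- The real conjugacy classes of `G`. -/
def realClasses (G : Type*) [Group G] : Set (ConjClasses G) :=
  classesContaining (fun g : G => IsRealElement g)

/-- The strongly real conjugacy classes of `G`. -/
def stronglyRealClasses (G : Type*) [Group G] : Set (ConjClasses G) :=
  classesContaining (fun g : G => IsStronglyRealElement g)

/-! ### The finite quotients of a local ring and their reductions -/

/-- For a local ring `R` with maximal ideal `m`, the quotient `R / m ^ ℓ`. -/
abbrev LevelRing (R : Type*) [CommRing R] [IsLocalRing R] (ℓ : ℕ) : Type _ :=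
  R ⧸ maximalIdeal R ^ ℓ

/-- The reduction map `R / m ^ ℓ → R / m` for `ℓ ≥ 1`. -/
noncomputable def levelReduction (R : Type*) [CommRing R] [IsLocalRing R] {ℓ : ℕ} (hℓ : 1 ≤ ℓ) :
    LevelRing R ℓ →+* ResidueField R :=
  Ideal.Quotient.lift (maximalIdeal R ^ ℓ) (residue R) (fun _ ha =>
    (residue_eq_zero_iff _).2 (Ideal.pow_le_self (Nat.one_le_iff_ne_zero.1 hℓ) ha))

/-- A square matrix over `R / m ^ ℓ` is regular if the minimal polynomial of its reduction over
the residue field equals the characteristic polynomial of that reduction. -/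
def IsRegularMatrix {R : Type*} [CommRing R] [IsLocalRing R] {ℓ : ℕ} (hℓ : 1 ≤ ℓ)
    (A : Matrix (Fin 2) (Fin 2) (LevelRing R ℓ)) : Prop :=
  minpoly (ResidueField R) (A.map (levelReduction R hℓ)) = (A.map (levelReduction R hℓ)).charpoly

/-! ### The unitary group -/

/-- `O / o` is an unramified quadratic extension of discrete valuation rings: `O` is finite of
rank two over `o`, and the maximal ideal of `o` generates the maximal ideal of `O`. -/
structure IsUnramifiedQuadratic (o O : Type*) [CommRing o] [IsLocalRing o]
    [CommRing O] [IsLocalRing O] [Algebra o O] : Prop where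
  finite : Module.Finite o O
  finrank_eq_two : Module.finrank o O = 2
  map_maximalIdeal : (maximalIdeal o).map (algebraMap o O) = maximalIdeal O

/-- The endomorphism of `O / P ^ ℓ` induced by an `o`-algebra automorphism of the
local ring `O`. -/
noncomputable def levelConj {o O : Type*} [CommRing o] [CommRing O] [IsLocalRing O] [Algebra o O]
    (σ : O ≃ₐ[o] O) (ℓ : ℕ) : LevelRing O ℓ →+* LevelRing O ℓ :=
  Ideal.quotientMap (maximalIdeal O ^ ℓ) (σ : O →+* O) (by
    rw [← Ideal.map_le_iff_le_comap, Ideal.map_pow]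
    exact Ideal.pow_right_mono (map_maximalIdeal_le (σ : O →+* O)) ℓ)

/-- The permutation matrix of the longest Weyl element. -/
def weylMatrix (S : Type*) [CommRing S] : Matrix (Fin 2) (Fin 2) S :=
  !![0, 1; 1, 0]

/-- The operation `(a i j)⋆ = W (c (a j i)) W⁻¹` on 2-by-2 matrices attached to a ring
endomorphism `c`. -/
noncomputable def starMatrix {S : Type*} [CommRing S] (c : S →+* S)
    (A : Matrix (Fin 2) (Fin 2) S) : Matrix (Fin 2) (Fin 2) S :=
  weylMatrix S * (A.map c)ᵀ * (weylMatrix S)⁻¹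

theorem weylMatrix_mul_self (S : Type*) [CommRing S] : weylMatrix S * weylMatrix S = 1 := by
  ext i j
  fin_cases i <;> fin_cases j <;> simp [weylMatrix, Matrix.mul_apply]

theorem weylMatrix_inv (S : Type*) [CommRing S] : (weylMatrix S)⁻¹ = weylMatrix S :=
  Matrix.inv_eq_right_inv (weylMatrix_mul_self S)

theorem starMatrix_one {S : Type*} [CommRing S] (c : S →+* S) : starMatrix c 1 = 1 := by
  simp [starMatrix, weylMatrix_inv, weylMatrix_mul_self, Matrix.map_one]

theorem starMatrix_mul {S : Type*} [CommRing S] (c : S →+* S)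
    (A B : Matrix (Fin 2) (Fin 2) S) :
    starMatrix c (A * B) = starMatrix c B * starMatrix c A := by
  have h := weylMatrix_mul_self S
  simp only [starMatrix, weylMatrix_inv, Matrix.map_mul, Matrix.transpose_mul]
  calc weylMatrix S * ((B.map c)ᵀ * (A.map c)ᵀ) * weylMatrix S
      = weylMatrix S * (B.map c)ᵀ * 1 * (A.map c)ᵀ * weylMatrix S := by
        simp only [Matrix.mul_assoc, Matrix.one_mul]
    _ = _ := by rw [← h]; simp only [Matrix.mul_assoc]

/-- The group of all `A` in `GL₂(S)` with `A⋆ A = I`. -/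
noncomputable def unitaryGroupTwo {S : Type*} [CommRing S] (c : S →+* S) :
    Subgroup (GL (Fin 2) S) where
  carrier := {A | starMatrix c (A : Matrix (Fin 2) (Fin 2) S) * A = 1}
  one_mem' := by simp [starMatrix_one]
  mul_mem' := by
    intro A B hA hB
    change starMatrix c A.val * A.val = 1 at hA
    change starMatrix c B.val * B.val = 1 at hB
    change starMatrix c (A.val * B.val) * (A.val * B.val) = 1
    rw [starMatrix_mul, Matrix.mul_assoc, ← Matrix.mul_assoc (starMatrix c A.val), hA, Matrix.one_mul, hB]
  inv_mem' := by
    intro A hA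
    change starMatrix c A.val * A.val = 1 at hA
    change starMatrix c (A⁻¹).val * (A⁻¹).val = 1
    have h : starMatrix c A.val = (A⁻¹).val := by
      calc starMatrix c A.val = starMatrix c A.val * (A.val * (A⁻¹).val) := by
            rw [Units.mul_inv, Matrix.mul_one]
        _ = (A⁻¹).val := by rw [← Matrix.mul_assoc, hA, Matrix.one_mul]
    calc starMatrix c (A⁻¹).val * (A⁻¹).val
        = starMatrix c (A⁻¹).val * starMatrix c A.val := by rw [h]
      _ = 1 := by rw [← starMatrix_mul, Units.mul_inv, starMatrix_one]

/-- `GL₂(o_ℓ)`. -/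
abbrev GLTwo (o : Type*) [CommRing o] [IsLocalRing o] (ℓ : ℕ) : Type _ :=
  GL (Fin 2) (LevelRing o ℓ)

/-- `GU₂(o_ℓ)`, a subgroup of `GL₂(O_ℓ)`, for the automorphism `σ` of `O` over `o`. -/
abbrev GUTwo {o O : Type*} [CommRing o] [CommRing O] [IsLocalRing O] [Algebra o O]
    (σ : O ≃ₐ[o] O) (ℓ : ℕ) : Type _ :=
  unitaryGroupTwo (levelConj σ ℓ)

/-! ### Regular classes -/

/-- The regular conjugacy classes of `GL₂(o_ℓ)`. -/
def GLTwo.regularClasses (o : Type*) [CommRing o] [IsLocalRing o] {ℓ : ℕ} (hℓ : 1 ≤ ℓ) :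
    Set (ConjClasses (GLTwo o ℓ)) :=
  classesContaining (fun A : GLTwo o ℓ => IsRegularMatrix hℓ A.val)

/-- The regular conjugacy classes of `GU₂(o_ℓ)`. -/
def GUTwo.regularClasses {o O : Type*} [CommRing o] [CommRing O] [IsLocalRing O] [Algebra o O]
    (σ : O ≃ₐ[o] O) {ℓ : ℕ} (hℓ : 1 ≤ ℓ) : Set (ConjClasses (GUTwo σ ℓ)) :=
  classesContaining (fun A : GUTwo σ ℓ => IsRegularMatrix hℓ A.val.val)

/-! Write R = o/℘^ℓ, S = O/𝔓^ℓ, and let ϖ generate the maximal ideal of R. In a local ring with 2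
invertible, x² = 1 forces x = ±1. Hence a real g in either group has det g = ±1, and tr g = det g ·
tr g. If det g = -1, the trace vanishes; such elements are regular and form a single class. If det g
= 1, then g⁻¹ = adj g, and g is similar to its adjugate (`isConj_adjugate`). In GL₂(R) the real
classes are therefore one extra regular class together with the similarity classes of matrices in
SL₂(R).

These have normal forms s·(1, -y; π, 1 - πy) (`exists_isConj_formOf`, `formOf_injective`). The
regular ones have s = π = 1 and are told apart by the trace, giving q^ℓ. The others have s = ±1, π =
ϖ^(i+1) and y ∈ (π), where π records how deep the matrix is scalar; each i < ℓ gives 2q^(ℓ-i-1).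

For the unitary group, write S = R[ε] with ε² = η a non-square unit and c(ε) = -ε. Conjugation by
diag(ε, 1) turns the unitary condition into c(g) = c(det g)·g with det g of norm 1. The elements of
determinant 1 are then exactly SL₂(R), and those of determinant -1 are εA with A over R. Two
elements of SL₂(R) are conjugate in this group exactly when they are similar over R: an intertwiner
over R can be rescaled because the norm hits every unit, and a unitary one descends through g ±
c(g). So `ncard_real_classes` gives the same counts for both groups.

For strong reality, an inverting involution of determinant 1 is -1, which only serves A = ±1. One of
determinant -1 is εM with M traceless, and it inverts A exactly when tr(MA) = 0. On a normal form
with y = πx this asks, residually, that a² - πx·ad + x·d² represent the non-square η⁻¹, which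
happens exactly when the discriminant (πx)² - 4x is a unit (`isStronglyRealElement_formOf_iff`). The
forms that fail number 2·∑_{i<ℓ} q^i, so q^ℓ remain; the class of determinant -1 consists of
involutions and adds one. -/

/-! ### Finite principal local rings of odd residue characteristic -/

/-- A finite local ring with principal maximal ideal generated by `ϖ`, in which `2` is a unit and
whose ideals `(ϖ ^ i)` have cardinality `q ^ (ℓ - i)`. -/
structure IsOddLevelRing (R : Type*) [CommRing R] [IsLocalRing R] (ϖ : R) (ℓ q : ℕ) : Prop where
  finite : Finite R
  isUnit_two : IsUnit (2 : R)
  maximalIdeal_eq : maximalIdeal R = Ideal.span {ϖ}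
  card_span : ∀ i ≤ ℓ, Nat.card (Ideal.span {ϖ ^ i}) = q ^ (ℓ - i)
  one_lt : 1 < q
  one_le : 1 ≤ ℓ

section LocalRing

variable {R : Type*} [CommRing R] [IsLocalRing R]

/-- The factors x + 1 and 1 - x add up to the unit 2, so one of them is a unit and can be cancelled.
-/
theorem eq_one_or_neg_one_of_sq_eq_one (h2 : IsUnit (2 : R)) {x : R} (hx : x * x = 1) :
    x = 1 ∨ x = -1 := by
  have h : (x + 1) * (x - 1) = 0 := by linear_combination hx
  have hu : IsUnit ((x + 1) + (1 - x)) := by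
    have : (x + 1) + (1 - x) = 2 := by ring
    rwa [this]
  rcases isUnit_or_isUnit_of_isUnit_add hu with h1 | h1
  · left
    exact sub_eq_zero.1 ((h1.mul_right_eq_zero).1 h)
  · right
    have h' : (1 - x) * (x + 1) = 0 := by linear_combination -h
    exact eq_neg_of_add_eq_zero_left ((h1.mul_right_eq_zero).1 h')

theorem isUnit_of_sub_mem_maximalIdeal {x y : R} (hy : IsUnit y) (h : x - y ∈ maximalIdeal R) :
    IsUnit x := by
  by_contra hx
  have hx' : x ∈ maximalIdeal R := (mem_maximalIdeal _).2 hx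
  have : y ∈ maximalIdeal R := by
    have := sub_mem hx' h
    rwa [sub_sub_cancel] at this
  exact (mem_maximalIdeal _).1 this hy

/-- Squaring maps the finite set 1 + m to itself and is injective there, because x² - y² = (x + y)(x
- y) and x + y ≡ 2 is a unit. Hence it is surjective, with no appeal to Hensel's lemma. -/
theorem isSquare_of_sub_one_mem [Finite R] (h2 : IsUnit (2 : R)) {u : R}
    (hu : u - 1 ∈ maximalIdeal R) : IsSquare u := by
  let s : Set R := {x | x - 1 ∈ maximalIdeal R}
  have hmaps : Set.MapsTo (fun x : R => x * x) s s := by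
    intro x hx
    have : x * x - 1 = (x + 1) * (x - 1) := by ring
    change x * x - 1 ∈ maximalIdeal R
    rw [this]
    exact Ideal.mul_mem_left _ _ hx
  have hinj : Set.InjOn (fun x : R => x * x) s := by
    intro x hx y hy hxy
    have h : (x + y) * (x - y) = 0 := by
      simp only at hxy
      linear_combination hxy
    have hunit : IsUnit (x + y) := by
      refine isUnit_of_sub_mem_maximalIdeal h2 ?_
      have : x + y - 2 = (x - 1) + (y - 1) := by ring
      rw [this]
      exact add_mem hx hy
    exact sub_eq_zero.1 ((hunit.mul_right_eq_zero).1 h)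
  obtain ⟨x, -, hx⟩ := ((Set.toFinite s).injOn_iff_bijOn_of_mapsTo hmaps).1 hinj |>.surjOn hu
  exact ⟨x, hx.symm⟩

theorem natCard_residueField_odd [Finite R] (h2 : IsUnit (2 : R)) [Fintype (ResidueField R)] :
    Fintype.card (ResidueField R) % 2 = 1 := by
  refine FiniteField.odd_card_of_char_ne_two fun h => ?_
  have h0 : (2 : ResidueField R) = 0 := by
    have := ringChar.Nat.cast_ringChar (R := ResidueField R)
    rw [h] at this
    exact_mod_cast this
  have : IsUnit (residue R 2) := h2.map _
  rw [map_ofNat, h0] at this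
  exact not_isUnit_zero this

/-- The form `a ^ 2 - Δ c ^ 2` represents every unit. -/
theorem exists_sq_sub_mul_sq_eq [Finite R] (h2 : IsUnit (2 : R)) {Δ v : R} (hΔ : IsUnit Δ)
    (hv : IsUnit v) : ∃ a c : R, a * a - Δ * (c * c) = v := by
  classical
  have : Finite (ResidueField R) := Finite.of_surjective _ (residue_surjective (R := R))
  have : Fintype (ResidueField R) := Fintype.ofFinite _
  have hΔ' : residue R Δ ≠ 0 := (hΔ.map (residue R)).ne_zero
  -- Over the residue field the value sets of a² - v and Δc² each contain more than half of the
  -- elements, so they meet.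
  obtain ⟨a, c, h⟩ := FiniteField.exists_root_sum_quadratic
    (f := Polynomial.C (1 : ResidueField R) * Polynomial.X ^ 2 + Polynomial.C 0 * Polynomial.X +
      Polynomial.C (-residue R v))
    (g := Polynomial.C (-residue R Δ) * Polynomial.X ^ 2 + Polynomial.C 0 * Polynomial.X +
      Polynomial.C 0)
    (Polynomial.degree_quadratic one_ne_zero)
    (Polynomial.degree_quadratic (neg_ne_zero.2 hΔ')) (natCard_residueField_odd h2)
  obtain ⟨a, rfl⟩ := residue_surjective a
  obtain ⟨c, rfl⟩ := residue_surjective c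
  obtain ⟨w, hw⟩ : ∃ w, w = a * a - Δ * (c * c) := ⟨_, rfl⟩
  have hwv : w - v ∈ maximalIdeal R := by
    rw [← residue_eq_zero_iff, hw]
    simp only [Polynomial.eval_add, Polynomial.eval_mul, Polynomial.eval_C, Polynomial.eval_pow,
      Polynomial.eval_X] at h
    simp only [map_sub, map_mul]
    linear_combination h
  obtain ⟨w', hw'⟩ := isUnit_of_sub_mem_maximalIdeal hv hwv
  have hww : w * ↑w'⁻¹ = 1 := by rw [← hw', Units.mul_inv]
  -- The lifted value w is only congruent to v; the quotient v/w lies in 1 + m, so it is a square z²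
  -- by which the solution is rescaled.
  obtain ⟨z, hz⟩ := isSquare_of_sub_one_mem h2 (u := v * ↑w'⁻¹) (by
    have : v * ↑w'⁻¹ - 1 = -(↑w'⁻¹ * (w - v)) := by linear_combination hww
    rw [this]
    exact neg_mem (Ideal.mul_mem_left _ _ hwv))
  refine ⟨z * a, z * c, ?_⟩
  linear_combination (-w) * hz + v * hww - z * z * hw

end LocalRing

/-! ### Divisibility by powers of the uniformizer in the finite quotient. -/

namespace IsOddLevelRing

variable {R : Type*} [CommRing R] [IsLocalRing R] {ϖ : R} {ℓ q : ℕ}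

theorem mem_maximalIdeal_iff (H : IsOddLevelRing R ϖ ℓ q) {x : R} :
    x ∈ maximalIdeal R ↔ ∃ y, x = ϖ * y := by
  rw [H.maximalIdeal_eq, Ideal.mem_span_singleton']
  exact ⟨fun ⟨a, h⟩ => ⟨a, by rw [← h, mul_comm]⟩, fun ⟨a, h⟩ => ⟨a, by rw [h, mul_comm]⟩⟩

theorem pow_eq_zero (H : IsOddLevelRing R ϖ ℓ q) : ϖ ^ ℓ = 0 := by
  have h := H.card_span ℓ le_rfl
  rw [Nat.sub_self, pow_zero, Nat.card_eq_one_iff_unique] at h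
  have := h.1
  have := Subsingleton.elim (⟨ϖ ^ ℓ, Ideal.mem_span_singleton_self _⟩ : Ideal.span {ϖ ^ ℓ}) 0
  exact congrArg Subtype.val this

theorem pow_ne_zero (H : IsOddLevelRing R ϖ ℓ q) {i : ℕ} (hi : i < ℓ) : ϖ ^ i ≠ 0 := by
  intro h0
  have h := H.card_span i hi.le
  rw [h0, Ideal.span_singleton_zero] at h
  have h1 : Nat.card (⊥ : Ideal R) = 1 := by simp
  have := Nat.one_lt_pow (Nat.sub_ne_zero_of_lt hi) H.one_lt
  omega

theorem natCard (H : IsOddLevelRing R ϖ ℓ q) : Nat.card R = q ^ ℓ := by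
  have h := H.card_span 0 (Nat.zero_le _)
  rw [pow_zero, Ideal.span_singleton_one, Nat.sub_zero] at h
  rw [← h]
  exact (Nat.card_congr (Equiv.Set.univ R)).symm

/-- This is the cancellation of ϖ ^ i that survives in R: it is valid only modulo m. If x - ϖy were
a unit, ϖ ^ i would vanish. -/
theorem mem_maximalIdeal_of_pow_mul_mem (H : IsOddLevelRing R ϖ ℓ q) {i : ℕ} (hi : i < ℓ) {x y : R}
    (h : ϖ ^ i * x = ϖ ^ (i + 1) * y) : x ∈ maximalIdeal R := by
  have hsub : x - ϖ * y ∈ maximalIdeal R := by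
    rw [mem_maximalIdeal]
    intro hu
    refine H.pow_ne_zero hi (hu.mul_left_eq_zero.1 ?_)
    linear_combination h
  have := add_mem hsub (H.mem_maximalIdeal_iff.2 ⟨y, rfl⟩)
  rwa [sub_add_cancel] at this

theorem self_mem (H : IsOddLevelRing R ϖ ℓ q) : ϖ ∈ maximalIdeal R :=
  H.mem_maximalIdeal_iff.2 ⟨1, (mul_one _).symm⟩

theorem four_notMem (H : IsOddLevelRing R ϖ ℓ q) : (4 : R) ∉ maximalIdeal R := fun h => by
  have : (4 : R) = 2 * 2 := by norm_num
  rw [this] at h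
  exact (mem_maximalIdeal _).1 h (H.isUnit_two.mul H.isUnit_two)

end IsOddLevelRing

/-! ### Similarity of 2-by-2 matrices -/

section Matrices

variable {R : Type*} [CommRing R]

theorem Matrix.det_eq_of_isConj {A B : Matrix (Fin 2) (Fin 2) R} (h : IsConj A B) :
    A.det = B.det := by
  obtain ⟨c, hc⟩ := h
  have := congrArg Matrix.det hc.eq
  rw [Matrix.det_mul, Matrix.det_mul, mul_comm] at this
  exact ((Matrix.isUnit_iff_isUnit_det _).1 c.isUnit).mul_right_cancel this

theorem Matrix.trace_eq_of_isConj {A B : Matrix (Fin 2) (Fin 2) R} (h : IsConj A B) :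
    A.trace = B.trace := by
  obtain ⟨c, hc⟩ := h
  have hB : B = c.val * A * (c⁻¹).val := by
    rw [hc.eq, Matrix.mul_assoc, Units.mul_inv, Matrix.mul_one]
  rw [hB, Matrix.trace_mul_comm, ← Matrix.mul_assoc, Units.inv_mul, Matrix.one_mul]

theorem Matrix.isConj_add_smul {A B : Matrix (Fin 2) (Fin 2) R} (h : IsConj A B) (a b : R) :
    IsConj (a • (1 : Matrix (Fin 2) (Fin 2) R) + b • A) (a • 1 + b • B) := by
  obtain ⟨c, hc⟩ := h
  refine ⟨c, ?_⟩
  have := hc.eq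
  simp only [SemiconjBy, Matrix.mul_add, Matrix.add_mul, Matrix.mul_smul, Matrix.smul_mul, this,
    Matrix.mul_one, Matrix.one_mul]

/-- A matrix over a local ring is residually scalar if it is scalar modulo the maximal ideal. -/
def IsResiduallyScalar [IsLocalRing R] (A : Matrix (Fin 2) (Fin 2) R) : Prop :=
  A 0 1 ∈ maximalIdeal R ∧ A 1 0 ∈ maximalIdeal R ∧ A 0 0 - A 1 1 ∈ maximalIdeal R

/-- The companion matrix of `X ^ 2 - t X + d`. -/
def companionTwo (t d : R) : Matrix (Fin 2) (Fin 2) R :=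
  !![0, -d; 1, t]

/-- A matrix that is not residually scalar has a cyclic vector: one of e₁, e₂, e₁ + e₂ works. -/
theorem isConj_companionTwo [IsLocalRing R] {A : Matrix (Fin 2) (Fin 2) R}
    (hA : ¬ IsResiduallyScalar A) : IsConj A (companionTwo A.trace A.det) := by
  -- For v = (x, y) the expression is the determinant of the matrix with columns v and Av.
  have key : ∀ x y : R, IsUnit (x * (A 1 0 * x + A 1 1 * y) - (A 0 0 * x + A 0 1 * y) * y) →
      IsConj A (companionTwo A.trace A.det) := by
    intro x y h
    let P : Matrix (Fin 2) (Fin 2) R := !![x, A 0 0 * x + A 0 1 * y; y, A 1 0 * x + A 1 1 * y]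
    have hP : IsUnit P := by
      rw [Matrix.isUnit_iff_isUnit_det, Matrix.det_fin_two_of]
      exact h
    refine IsConj.symm ⟨hP.unit, ?_⟩
    change P * companionTwo A.trace A.det = A * P
    ext i j
    fin_cases i <;> fin_cases j <;>
      simp [P, companionTwo, Matrix.mul_apply, Fin.sum_univ_two, Matrix.trace_fin_two,
        Matrix.det_fin_two] <;> ring
  by_cases h1 : A 1 0 ∈ maximalIdeal R
  · by_cases h2 : A 0 1 ∈ maximalIdeal R
    · have h3 : A 0 0 - A 1 1 ∉ maximalIdeal R := fun h => hA ⟨h2, h1, h⟩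
      refine key 1 1 (not_not.1 fun hu => h3 ?_)
      have hm := (mem_maximalIdeal _).2 hu
      have := sub_mem (sub_mem h1 h2) hm
      convert this using 1
      ring
    · refine key 0 1 (not_not.1 fun hu => h2 ?_)
      have := neg_mem ((mem_maximalIdeal _).2 hu)
      convert this using 1
      ring
  · refine key 1 0 (not_not.1 fun hu => h1 ?_)
    have := (mem_maximalIdeal _).2 hu
    convert this using 1
    ring

theorem isConj_of_trace_det [IsLocalRing R] {A B : Matrix (Fin 2) (Fin 2) R}
    (hA : ¬ IsResiduallyScalar A) (hB : ¬ IsResiduallyScalar B) (ht : A.trace = B.trace)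
    (hd : A.det = B.det) : IsConj A B := by
  refine (isConj_companionTwo hA).trans ?_
  rw [ht, hd]
  exact (isConj_companionTwo hB).symm

theorem exists_eq_add_smul_of_isResiduallyScalar [IsLocalRing R] {ϖ : R} {ℓ q : ℕ}
    (H : IsOddLevelRing R ϖ ℓ q) {A : Matrix (Fin 2) (Fin 2) R} (hA : IsResiduallyScalar A) :
    ∃ (a : R) (B : Matrix (Fin 2) (Fin 2) R), A = a • 1 + ϖ • B := by
  obtain ⟨h1, h2, h3⟩ := hA
  obtain ⟨b, hb⟩ := H.mem_maximalIdeal_iff.1 h1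
  obtain ⟨c, hc⟩ := H.mem_maximalIdeal_iff.1 h2
  obtain ⟨d, hd⟩ := H.mem_maximalIdeal_iff.1 h3
  refine ⟨A 1 1, !![d, b; c, 0], ?_⟩
  ext i j
  fin_cases i <;> fin_cases j <;> simp [hb, hc, ← hd]

theorem isResiduallyScalar_add_smul [IsLocalRing R] {ϖ : R} (h : ϖ ∈ maximalIdeal R) (a : R)
    (B : Matrix (Fin 2) (Fin 2) R) : IsResiduallyScalar (a • 1 + ϖ • B) := by
  refine ⟨?_, ?_, ?_⟩
  · simpa using Ideal.mul_mem_right _ _ h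
  · simpa using Ideal.mul_mem_right _ _ h
  · have : (a • 1 + ϖ • B) 0 0 - (a • 1 + ϖ • B) 1 1 = ϖ * (B 0 0 - B 1 1) := by
      simp
      ring
    rw [this]
    exact Ideal.mul_mem_right _ _ h

theorem isResiduallyScalar_iff [IsLocalRing R] {A : Matrix (Fin 2) (Fin 2) R} :
    IsResiduallyScalar A ↔ ∃ k : ResidueField R, A.map (residue R) = k • 1 := by
  simp only [IsResiduallyScalar, ← residue_eq_zero_iff, map_sub, sub_eq_zero]
  constructor
  · rintro ⟨h1, h2, h3⟩
    refine ⟨residue R (A 1 1), ?_⟩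
    ext i j
    fin_cases i <;> fin_cases j <;> simp [h1, h2, h3]
  · rintro ⟨k, hk⟩
    have h := fun i j => congrFun (congrFun hk i) j
    simp only [Matrix.map_apply] at h
    simp [h]

theorem isResiduallyScalar_of_isConj [IsLocalRing R] {A B : Matrix (Fin 2) (Fin 2) R}
    (h : IsConj A B) (hA : IsResiduallyScalar A) : IsResiduallyScalar B := by
  rw [isResiduallyScalar_iff] at hA ⊢
  obtain ⟨k, hk⟩ := hA
  obtain ⟨c, hc⟩ := h
  refine ⟨k, ?_⟩
  have hB : B = c.val * A * (c⁻¹).val := by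
    rw [hc.eq, Matrix.mul_assoc, Units.mul_inv, Matrix.mul_one]
  rw [hB, Matrix.map_mul, Matrix.map_mul, hk, Matrix.mul_smul, Matrix.mul_one, Matrix.smul_mul,
    ← Matrix.map_mul, Units.mul_inv, Matrix.map_one _ (map_zero _) (map_one _)]

/-- Two matrices that become similar after multiplication by `r` have determinants that agree
after multiplication by `r`. -/
theorem mul_det_eq_of_isConj_smul {r : R} {A B : Matrix (Fin 2) (Fin 2) R}
    (h : IsConj (r • A) (r • B)) : r * A.det = r * B.det := by
  obtain ⟨c, hc⟩ := h
  -- Modulo the annihilator of r, the factor r can be cancelled and A, B themselves become similar.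
  let I : Ideal R := Submodule.torsionBy R R r
  have hI : ∀ x y : R, r * x = r * y ↔ Ideal.Quotient.mk I x = Ideal.Quotient.mk I y := by
    intro x y
    rw [Ideal.Quotient.mk_eq_mk_iff_sub_mem, Submodule.mem_torsionBy_iff, smul_eq_mul, mul_sub,
      sub_eq_zero]
  let f := (Ideal.Quotient.mk I).mapMatrix (m := Fin 2)
  have hf : f c.val * f A = f B * f c.val := by
    rw [← map_mul, ← map_mul]
    ext i j
    refine (hI _ _).1 ?_
    have := congrFun (congrFun hc.eq i) j
    simpa only [Matrix.mul_smul, Matrix.smul_mul, Matrix.smul_apply, smul_eq_mul] using this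
  have hconj : IsConj (f A) (f B) := ⟨Units.map f.toMonoidHom c, hf⟩
  rw [hI, RingHom.map_det, RingHom.map_det]
  exact Matrix.det_eq_of_isConj hconj

end Matrices

/-! ### Normal forms for similarity classes of matrices of determinant one -/

section NormalForm

variable {R : Type*} [CommRing R]

theorem intUnits_cast_mul_self (s : ℤˣ) : ((s : ℤ) : R) * ((s : ℤ) : R) = 1 := by
  rcases Int.units_eq_one_or s with rfl | rfl <;> simp

/-- The matrix `s • !![1, -y; π, 1 - π * y]` of determinant one. -/
def normalForm (s : ℤˣ) (π y : R) : SpecialLinearGroup (Fin 2) R :=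
  ⟨!![((s : ℤ) : R), -((s : ℤ) : R) * y; ((s : ℤ) : R) * π, ((s : ℤ) : R) * (1 - π * y)], by
    rw [Matrix.det_fin_two_of]
    linear_combination intUnits_cast_mul_self (R := R) s⟩

/-- The index set of the normal forms. -/
abbrev FormIndex (ϖ : R) (ℓ : ℕ) : Type _ :=
  R ⊕ (Σ i : Fin ℓ, ℤˣ × Ideal.span {ϖ ^ (i.val + 1)})

/-- The normal form with a given index. -/
def formOf {ϖ : R} {ℓ : ℕ} : FormIndex ϖ ℓ → SpecialLinearGroup (Fin 2) R
  | Sum.inl y => normalForm 1 1 y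
  | Sum.inr ⟨i, s, y⟩ => normalForm s (ϖ ^ (i.val + 1)) y

/-- For C of determinant x, the matrix 1 + πC has determinant one if tr C = -πx; this explains the
trace -y of the companion block. -/
theorem normalForm_eq (s : ℤˣ) {π y x : R} (hy : y = π * x) :
    (normalForm s π y).val = ((s : ℤ) : R) • 1 + π • (((s : ℤ) : R) • companionTwo (-y) x) := by
  ext i j
  fin_cases i <;> fin_cases j <;> simp [normalForm, companionTwo, hy] <;> ring

/-- An explicit traceless intertwiner exists over any commutative ring, so reality in determinant
one only needs the reduction to normal forms. -/
theorem isConj_normalForm_adjugate (s : ℤˣ) (π y : R) :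
    IsConj (normalForm s π y).val (normalForm s π y).val.adjugate := by
  have hP : IsUnit (!![1, -y; 0, -1] : Matrix (Fin 2) (Fin 2) R) := by
    rw [Matrix.isUnit_iff_isUnit_det, Matrix.det_fin_two_of]
    simp
  refine ⟨hP.unit, ?_⟩
  change !![1, -y; 0, -1] * (normalForm s π y).val = (normalForm s π y).val.adjugate * !![1, -y; 0, -1]
  rw [Matrix.adjugate_fin_two]
  ext i j
  fin_cases i <;> fin_cases j <;> simp [normalForm, Matrix.mul_apply, Fin.sum_univ_two] <;> ring

variable [IsLocalRing R] {ϖ : R} {ℓ q : ℕ}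

theorem formOf_inl_not_isResiduallyScalar (y : R) :
    ¬ IsResiduallyScalar (formOf (ϖ := ϖ) (ℓ := ℓ) (Sum.inl y)).val := fun h =>
  (mem_maximalIdeal _).1 h.2.1 (by simp [formOf, normalForm])

theorem formOf_inr_isResiduallyScalar (H : IsOddLevelRing R ϖ ℓ q)
    (a : Σ i : Fin ℓ, ℤˣ × Ideal.span {ϖ ^ (i.val + 1)}) :
    IsResiduallyScalar (formOf (Sum.inr a)).val := by
  obtain ⟨i, s, y, hy⟩ := a
  obtain ⟨x, rfl⟩ := Ideal.mem_span_singleton'.1 hy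
  change IsResiduallyScalar (normalForm s (ϖ ^ (i.val + 1)) _).val
  rw [normalForm_eq s (mul_comm x _)]
  exact isResiduallyScalar_add_smul (Ideal.pow_mem_of_mem _ H.self_mem _ (Nat.succ_pos _)) _ _

/-- Being scalar modulo ϖ ^ i is invariant under similarity, whereas the lower left entry ±ϖ ^ j is
not divisible by ϖ ^ i when j < i. -/
theorem le_of_isConj_normalForm (H : IsOddLevelRing R ϖ ℓ q) {i j : ℕ} (hj : j < ℓ)
    {s t : ℤˣ} {x y : R} (hx : x ∈ Ideal.span {ϖ ^ i})
    (h : IsConj (normalForm s (ϖ ^ i) x).val (normalForm t (ϖ ^ j) y).val) : i ≤ j := by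
  by_contra! hlt
  obtain ⟨x, rfl⟩ := Ideal.mem_span_singleton'.1 hx
  rw [normalForm_eq s (mul_comm x _)] at h
  obtain ⟨c, hc⟩ := h
  set C := ((s : ℤ) : R) • companionTwo (-(x * ϖ ^ i)) x
  have hB : (normalForm t (ϖ ^ j) y).val =
      ((s : ℤ) : R) • 1 + ϖ ^ i • (c.val * C * (c⁻¹).val) := by
    have : (normalForm t (ϖ ^ j) y).val =
        c.val * (((s : ℤ) : R) • 1 + ϖ ^ i • C) * (c⁻¹).val := by
      rw [hc.eq, Matrix.mul_assoc, Units.mul_inv, Matrix.mul_one]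
    rw [this, Matrix.mul_add, Matrix.add_mul, Matrix.mul_smul, Matrix.smul_mul, Matrix.mul_one,
      Units.mul_inv, Matrix.mul_smul, Matrix.smul_mul]
  have h10 := congrFun (congrFun hB 1) 0
  simp only [normalForm, of_apply, cons_val', cons_val_zero, cons_val_one,
    Matrix.add_apply, Matrix.smul_apply, Matrix.one_apply_ne one_ne_zero, smul_eq_mul, mul_zero,
    zero_add] at h10
  set d := (c.val * C * (c⁻¹).val) 1 0
  obtain ⟨k, rfl⟩ := Nat.exists_eq_add_of_lt hlt
  have hmem := H.mem_maximalIdeal_of_pow_mul_mem hj (x := 1) (y := ϖ ^ k * ((t : ℤ) : R) * d) (by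
    have := intUnits_cast_mul_self (R := R) t
    linear_combination ((t : ℤ) : R) * h10 - ϖ ^ j * this)
  exact (mem_maximalIdeal _).1 hmem isUnit_one

/-- The traces are congruent to 2s and 2t modulo m, so opposite signs would put 4 in m. -/
theorem sign_eq_of_isConj_normalForm (H : IsOddLevelRing R ϖ ℓ q) {i j : ℕ}
    {s t : ℤˣ} {x y : R} (hx : x ∈ maximalIdeal R) (hy : y ∈ maximalIdeal R)
    (h : IsConj (normalForm s (ϖ ^ i) x).val (normalForm t (ϖ ^ j) y).val) : s = t := by
  have ht := Matrix.trace_eq_of_isConj h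
  simp only [normalForm, Matrix.trace_fin_two_of] at ht
  have hm : ∀ a b : R, (4 : R) = a * x + b * y → False := fun a b h => H.four_notMem (by
    rw [h]
    exact add_mem (Ideal.mul_mem_left _ _ hx) (Ideal.mul_mem_left _ _ hy))
  rcases Int.units_eq_one_or s with rfl | rfl <;> rcases Int.units_eq_one_or t with rfl | rfl
  · rfl
  · refine (hm (ϖ ^ i) (ϖ ^ j) ?_).elim
    push_cast [Units.val_one, Units.val_neg] at ht
    linear_combination ht
  · refine (hm (ϖ ^ i) (ϖ ^ j) ?_).elim
    push_cast [Units.val_one, Units.val_neg] at ht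
    linear_combination -ht
  · rfl

/-- Regular forms are separated by the trace 2 - y. For the others the sign and the exponent are
invariants; the determinant of the companion block is then visible only after multiplication by π,
so that πx = y, and not x, is the invariant. -/
theorem formOf_injective (H : IsOddLevelRing R ϖ ℓ q) {a b : FormIndex ϖ ℓ}
    (h : IsConj (formOf a).val (formOf b).val) : a = b := by
  rcases a with y | a <;> rcases b with y' | b
  · have ht := Matrix.trace_eq_of_isConj h
    simp [formOf, normalForm, Matrix.trace_fin_two_of] at ht
    rw [ht]
  · exact (formOf_inl_not_isResiduallyScalar y (isResiduallyScalar_of_isConj h.symm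
      (formOf_inr_isResiduallyScalar H b))).elim
  · exact (formOf_inl_not_isResiduallyScalar y' (isResiduallyScalar_of_isConj h
      (formOf_inr_isResiduallyScalar H a))).elim
  · obtain ⟨i, s, x, hx⟩ := a
    obtain ⟨j, t, y, hy⟩ := b
    change IsConj (normalForm s (ϖ ^ (i.val + 1)) x).val (normalForm t (ϖ ^ (j.val + 1)) y).val at h
    have hle : ∀ i : ℕ, Ideal.span {ϖ ^ (i + 1)} ≤ maximalIdeal R := fun i => by
      rw [Ideal.span_singleton_le_iff_mem]
      exact Ideal.pow_mem_of_mem _ H.self_mem _ (Nat.succ_pos _)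
    obtain rfl := sign_eq_of_isConj_normalForm H (hle _ hx) (hle _ hy) h
    have hij : i = j := by
      rcases lt_trichotomy i j with hlt | rfl | hlt
      · have := le_of_isConj_normalForm H (by omega) hy h.symm
        omega
      · rfl
      · have := le_of_isConj_normalForm H (by omega) hx h
        omega
    subst hij
    obtain ⟨x, rfl⟩ := Ideal.mem_span_singleton'.1 hx
    obtain ⟨y, rfl⟩ := Ideal.mem_span_singleton'.1 hy
    have hs := intUnits_cast_mul_self (R := R) s
    have h' : IsConj (ϖ ^ (i.val + 1) • companionTwo (-(x * ϖ ^ (i.val + 1))) x)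
        (ϖ ^ (i.val + 1) • companionTwo (-(y * ϖ ^ (i.val + 1))) y) := by
      rw [normalForm_eq s (mul_comm x _), normalForm_eq s (mul_comm y _)] at h
      have := Matrix.isConj_add_smul h (-1) ((s : ℤ) : R)
      simpa only [smul_add, smul_smul, mul_left_comm _ (ϖ ^ (i.val + 1)), hs, mul_one, one_smul,
        neg_smul, neg_add_cancel_left] using this
    have hd := mul_det_eq_of_isConj_smul h'
    simp only [companionTwo, Matrix.det_fin_two_of] at hd
    have hxy : x * ϖ ^ (i.val + 1) = y * ϖ ^ (i.val + 1) := by linear_combination hd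
    simp only [hxy]

/-- Descending induction on the depth i to which A is the scalar s. If B is still residually scalar,
determinant one forces its scalar part into m and the depth increases; otherwise the companion form
of sB gives the normal form. -/
theorem exists_isConj_formOf_of_eq_add_smul (H : IsOddLevelRing R ϖ ℓ q) (k : ℕ) :
    ∀ i : ℕ, 1 ≤ i → i + k = ℓ → ∀ (A B : Matrix (Fin 2) (Fin 2) R) (s : ℤˣ), A.det = 1 →
      A = ((s : ℤ) : R) • 1 + ϖ ^ i • B →
      ∃ a : FormIndex ϖ ℓ, IsConj A (formOf a).val := by
  induction k with
  | zero =>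
    intro i hi hk A B s hdet hA
    obtain rfl : i = ℓ := hk
    obtain ⟨j, rfl⟩ := Nat.exists_eq_add_of_le' hi
    -- At depth ℓ the matrix equals s, and y = 0 is the only element of the zero ideal.
    refine ⟨Sum.inr ⟨⟨j, Nat.lt_succ_self j⟩, s, 0⟩, ?_⟩
    change IsConj A (normalForm s (ϖ ^ (j + 1)) 0).val
    rw [normalForm_eq s (mul_zero _).symm, hA, H.pow_eq_zero, zero_smul, zero_smul]
  | succ k ih =>
    intro i hi hk A B s hdet hA
    have hs := intUnits_cast_mul_self (R := R) s
    obtain ⟨j, rfl⟩ := Nat.exists_eq_add_of_le' hi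
    by_cases hB : IsResiduallyScalar (((s : ℤ) : R) • B)
    · obtain ⟨b, C, hC⟩ := exists_eq_add_smul_of_isResiduallyScalar H hB
      have hB' : B = (((s : ℤ) : R) * b) • 1 + (((s : ℤ) : R) * ϖ) • C := by
        have := congrArg (fun M => ((s : ℤ) : R) • M) hC
        simpa only [smul_smul, hs, one_smul, smul_add] using this
      -- Expansion of det A = 1: every term other than 2bϖ ^ (j + 1) carries one more factor ϖ.
      have h1 : ϖ ^ (j + 1) * (2 * b) = ϖ ^ (j + 1 + 1) * (-(C.trace + ϖ ^ j * b * b +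
          ϖ ^ (j + 1) * b * C.trace + ϖ ^ (j + 2) * C.det)) := by
        rw [hA, hB'] at hdet
        simp only [Matrix.det_fin_two, Matrix.trace_fin_two, Matrix.add_apply, Matrix.smul_apply,
          smul_eq_mul, Matrix.one_apply_eq, Matrix.one_apply_ne zero_ne_one,
          Matrix.one_apply_ne one_ne_zero] at hdet ⊢
        generalize ((s : ℤ) : R) = s' at *
        have e : s' ^ 2 = 1 := by rw [sq, hs]
        ring_nf at hdet
        simp only [e] at hdet
        linear_combination hdet
      have hb : b ∈ maximalIdeal R := by
        have := H.mem_maximalIdeal_of_pow_mul_mem (by omega) h1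
        exact (Ideal.unit_mul_mem_iff_mem _ H.isUnit_two).1 this
      obtain ⟨b', rfl⟩ := H.mem_maximalIdeal_iff.1 hb
      refine ih (j + 1 + 1) (by omega) (by omega) A (((s : ℤ) : R) • (b' • 1 + C)) s hdet ?_
      rw [hA, hB']
      congr 1
      simp only [smul_add, smul_smul]
      congr 2 <;> ring
    · obtain ⟨x, hx⟩ : ∃ x, x = (((s : ℤ) : R) • B).det := ⟨_, rfl⟩
      obtain ⟨t, ht⟩ : ∃ t, t = (((s : ℤ) : R) • B).trace := ⟨_, rfl⟩
      refine ⟨Sum.inr ⟨⟨j, by omega⟩, s, ⟨x * ϖ ^ (j + 1),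
        Ideal.mem_span_singleton'.2 ⟨x, rfl⟩⟩⟩, ?_⟩
      change IsConj A (normalForm s (ϖ ^ (j + 1)) (x * ϖ ^ (j + 1))).val
      have h1 := Matrix.isConj_add_smul (isConj_companionTwo hB) ((s : ℤ) : R)
        (((s : ℤ) : R) * ϖ ^ (j + 1))
      rw [← hx, ← ht] at h1
      rw [hA]
      have hB' : ϖ ^ (j + 1) • B = (((s : ℤ) : R) * ϖ ^ (j + 1)) • (((s : ℤ) : R) • B) := by
        rw [smul_smul, mul_right_comm, hs, one_mul]
      rw [hB']
      convert h1 using 1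
      have hdet' := Matrix.det_eq_of_isConj h1
      rw [← hB', ← hA, hdet] at hdet'
      simp only [companionTwo, Matrix.det_fin_two, Matrix.add_apply, Matrix.smul_apply,
        smul_eq_mul, Matrix.one_apply_eq, Matrix.one_apply_ne zero_ne_one,
        Matrix.one_apply_ne one_ne_zero, of_apply, cons_val', cons_val_zero, cons_val_one] at hdet'
      -- Determinant one expresses ϖ ^ (j + 1) * t through x, which replaces the trace t by -y in
      -- the lower right entry.
      have h0 : ϖ ^ (j + 1) * t + ϖ ^ (j + 1) * ϖ ^ (j + 1) * x = 0 := by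
        generalize ((s : ℤ) : R) = s' at *
        linear_combination (-1) * hdet' + (1 - (1 + ϖ ^ (j + 1) * t) -
          ϖ ^ (j + 1) * ϖ ^ (j + 1) * x) * hs - hs
      ext i j
      fin_cases i <;> fin_cases j <;> simp [normalForm, companionTwo]
      · ring
      · linear_combination (-((s : ℤ) : R)) * h0

theorem exists_isConj_formOf (H : IsOddLevelRing R ϖ ℓ q) (A : SpecialLinearGroup (Fin 2) R) :
    ∃ a : FormIndex ϖ ℓ, IsConj A.val (formOf a).val := by
  by_cases hA : IsResiduallyScalar A.val
  · obtain ⟨a, B, hB⟩ := exists_eq_add_smul_of_isResiduallyScalar H hA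
    have hdet := A.2
    rw [hB] at hdet
    simp only [Matrix.det_fin_two, Matrix.add_apply, Matrix.smul_apply,
      smul_eq_mul, Matrix.one_apply_eq, Matrix.one_apply_ne zero_ne_one,
      Matrix.one_apply_ne one_ne_zero] at hdet
    -- The determinant is congruent to a², so a ≡ ±1 and the induction starts at depth 1 with that
    -- sign.
    have hmem : (a - 1) * (a + 1) ∈ maximalIdeal R :=
      H.mem_maximalIdeal_iff.2 ⟨-(a * B.trace + ϖ * B.det), by
        simp only [Matrix.det_fin_two, Matrix.trace_fin_two]
        linear_combination hdet⟩
    obtain ⟨s, b, hb⟩ : ∃ (s : ℤˣ) (b : R), a = ((s : ℤ) : R) + ϖ * b := by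
      rcases (inferInstance : (maximalIdeal R).IsPrime).mem_or_mem hmem with h | h
      · obtain ⟨b, hb⟩ := H.mem_maximalIdeal_iff.1 h
        exact ⟨1, b, by push_cast [Units.val_one]; linear_combination hb⟩
      · obtain ⟨b, hb⟩ := H.mem_maximalIdeal_iff.1 h
        exact ⟨-1, b, by push_cast [Units.val_one, Units.val_neg]; linear_combination hb⟩
    obtain ⟨k, hk⟩ := Nat.exists_eq_add_of_le H.one_le
    refine exists_isConj_formOf_of_eq_add_smul H k 1 le_rfl hk.symm A.val (b • 1 + B) s A.2 ?_
    rw [hB, hb, pow_one, smul_add, add_smul, smul_smul, add_assoc]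
  · refine ⟨Sum.inl (2 - A.val.trace), isConj_of_trace_det hA
      (formOf_inl_not_isResiduallyScalar _) ?_ (by rw [A.2, (formOf _).2])⟩
    simp only [formOf, normalForm, Matrix.trace_fin_two_of]
    push_cast [Units.val_one]
    ring

/-- Since adj M = tr M - M, adjugation commutes with conjugation, and the similarity is transported
from the normal form. Equality of trace and determinant would settle only the regular case. -/
theorem isConj_adjugate (H : IsOddLevelRing R ϖ ℓ q) (A : SpecialLinearGroup (Fin 2) R) :
    IsConj A.val A.val.adjugate := by
  obtain ⟨a, ha⟩ := exists_isConj_formOf H A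
  have h1 : IsConj (formOf a).val (formOf a).val.adjugate := by
    rcases a with y | ⟨i, s, y⟩ <;> exact isConj_normalForm_adjugate _ _ _
  refine (ha.trans h1).trans ?_
  obtain ⟨c, hc⟩ := ha.symm
  refine ⟨c, ?_⟩
  have e : ∀ M : Matrix (Fin 2) (Fin 2) R, M.adjugate = M.trace • 1 - M := fun M => by
    rw [Matrix.adjugate_fin_two, Matrix.trace_fin_two]
    ext i j
    fin_cases i <;> fin_cases j <;> simp
  rw [e, e, ← Matrix.trace_eq_of_isConj ⟨c, hc⟩]
  simp only [SemiconjBy, Matrix.mul_sub, Matrix.sub_mul, Matrix.mul_smul, Matrix.smul_mul,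
    Matrix.mul_one, Matrix.one_mul, hc.eq]

/-! ### Cardinalities of sets of normal forms -/

/-- The shift k = 0 counts the residually scalar forms, and k = 1 the weak ones among them. -/
theorem natCard_sigma_span (H : IsOddLevelRing R ϖ ℓ q) (n k : ℕ) (hn : n + k = ℓ) :
    Nat.card (Σ i : Fin n, ℤˣ × Ideal.span {ϖ ^ (i.val + (k + 1))}) =
      2 * ∑ i ∈ Finset.range n, q ^ i := by
  have := H.finite
  have h : ∀ i : Fin n, Nat.card (ℤˣ × Ideal.span {ϖ ^ (i.val + (k + 1))}) =
      2 * q ^ (n - 1 - i.val) := by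
    intro i
    rw [Nat.card_prod, H.card_span _ (by omega), Nat.card_eq_fintype_card, Fintype.card_units_int]
    congr 2
    omega
  rw [Nat.card_sigma, Finset.sum_congr rfl (fun i _ => h i), ← Finset.mul_sum,
    Fin.sum_univ_eq_sum_range (fun i => q ^ (n - 1 - i)) n, Finset.sum_range_reflect]

/-- The indices of the normal forms that are inverted by an involution in the unitary group. -/
def IsStrongIndex : FormIndex ϖ ℓ → Prop
  | Sum.inl y => y ∉ maximalIdeal R ∧ y - 4 ∉ maximalIdeal R
  | Sum.inr ⟨i, _, y⟩ => i.val + 1 = ℓ ∨ y.val ∉ Ideal.span {ϖ ^ (i.val + 2)}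

/-- A parametrization of the indices that are not strong. -/
def weakIndex {n : ℕ} : (maximalIdeal R ⊕ maximalIdeal R) ⊕
    (Σ i : Fin n, ℤˣ × Ideal.span {ϖ ^ (i.val + (1 + 1))}) → FormIndex ϖ (n + 1)
  | Sum.inl (Sum.inl y) => Sum.inl y.val
  | Sum.inl (Sum.inr y) => Sum.inl (y.val + 4)
  | Sum.inr ⟨i, s, y⟩ => Sum.inr ⟨i.castSucc, s, ⟨y.val,
      Ideal.span_singleton_le_span_singleton.2 (pow_dvd_pow ϖ (Nat.le_succ _)) y.2⟩⟩

theorem weakIndex_injective {n : ℕ} (H : IsOddLevelRing R ϖ (n + 1) q) :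
    Function.Injective (weakIndex (ϖ := ϖ) (n := n)) := by
  have h4 : ∀ x y : maximalIdeal R, x.val ≠ y.val + 4 := fun x y h => H.four_notMem (by
    have := sub_mem x.2 y.2
    rwa [h, add_sub_cancel_left] at this)
  rintro ((x | x) | ⟨i, s, x⟩) ((y | y) | ⟨j, t, y⟩) h
  · simp only [weakIndex, Sum.inl.injEq] at h
    rw [Subtype.ext h]
  · simp only [weakIndex, Sum.inl.injEq] at h
    exact (h4 _ _ h).elim
  · simp [weakIndex] at h
  · simp only [weakIndex, Sum.inl.injEq] at h
    exact (h4 _ _ h.symm).elim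
  · simp only [weakIndex, Sum.inl.injEq, add_left_inj] at h
    rw [Subtype.ext h]
  · simp [weakIndex] at h
  · simp [weakIndex] at h
  · simp [weakIndex] at h
  · simp only [weakIndex, Sum.inr.injEq, Sigma.mk.injEq, Fin.castSucc_inj] at h
    obtain ⟨rfl, h⟩ := h
    simp only [heq_eq_eq, Prod.mk.injEq, Subtype.mk.injEq] at h
    obtain ⟨rfl, h⟩ := h
    rw [Subtype.ext h]

theorem range_weakIndex {n : ℕ} :
    Set.range (weakIndex (ϖ := ϖ) (n := n)) = {a | IsStrongIndex a}ᶜ := by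
  ext a
  simp only [Set.mem_range, Set.mem_compl_iff, Set.mem_ofPred_eq]
  constructor
  · rintro ⟨(y | y) | ⟨i, s, y⟩, rfl⟩
    · exact fun h => h.1 y.2
    · exact fun h => h.2 (by simp)
    · rintro (h | h)
      · have := i.2
        simp only [Fin.val_castSucc] at h
        omega
      · exact h y.2
  · intro h
    rcases a with y | ⟨i, s, y⟩
    · by_cases hy : y ∈ maximalIdeal R
      · exact ⟨Sum.inl (Sum.inl ⟨y, hy⟩), rfl⟩
      · have h' : y - 4 ∈ maximalIdeal R := not_not.1 fun h4 => h ⟨hy, h4⟩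
        exact ⟨Sum.inl (Sum.inr ⟨y - 4, h'⟩), by simp [weakIndex]⟩
    · simp only [IsStrongIndex, not_or, not_not] at h
      have hi : i.val < n := by omega
      exact ⟨Sum.inr ⟨⟨i.val, hi⟩, s, ⟨y.val, h.2⟩⟩, rfl⟩

theorem natCard_formIndex (H : IsOddLevelRing R ϖ ℓ q) :
    Nat.card (FormIndex ϖ ℓ) = q ^ ℓ + 2 * ∑ i ∈ Finset.range ℓ, q ^ i := by
  have := H.finite
  rw [Nat.card_sum, H.natCard, ← natCard_sigma_span H ℓ 0 (Nat.add_zero _)]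

/-- With ℓ = n + 1, the 2q^n weak regular indices offset the top term of 2·∑_{i≤n} q^i, and the weak
residually scalar ones offset the rest, leaving q^ℓ. -/
theorem ncard_isStrongIndex (H : IsOddLevelRing R ϖ ℓ q) :
    {a : FormIndex ϖ ℓ | IsStrongIndex a}.ncard = q ^ ℓ := by
  have := H.finite
  obtain ⟨n, rfl⟩ := Nat.exists_eq_add_of_le' H.one_le
  have h := Set.ncard_add_ncard_compl {a : FormIndex ϖ (n + 1) | IsStrongIndex a}
  have hm : Nat.card (maximalIdeal R) = q ^ n := by
    have := H.card_span 1 (by omega)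
    rwa [pow_one, ← H.maximalIdeal_eq] at this
  rw [natCard_formIndex H, ← range_weakIndex, ← Nat.card_coe_set_eq (Set.range weakIndex),
    Nat.card_range_of_injective (weakIndex_injective H), Nat.card_sum, Nat.card_sum,
    natCard_sigma_span H n 1 rfl, hm, Finset.sum_range_succ] at h
  omega

/-! ### Counting real classes -/

variable {G : Type*} [Group G]

/-- Common framework for both groups: `f` embeds SL₂(R) so that conjugacy becomes similarity over R,
and `w` represents the class of determinant -1. -/
theorem classesContaining_eq (H : IsOddLevelRing R ϖ ℓ q) (f : SpecialLinearGroup (Fin 2) R → G) (w : G)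
    (hf : ∀ A B, IsConj (f A) (f B) ↔ IsConj A.val B.val) {P : G → Prop}
    {Q : FormIndex ϖ ℓ → Prop} (hP : ∀ g h, IsConj g h → P g → P h)
    (hPQ : ∀ a, P (f (formOf a)) ↔ Q a) (hw : P w)
    (hreal : ∀ g, P g → (∃ A, g = f A) ∨ IsConj g w) :
    classesContaining P =
      insert (ConjClasses.mk w) ((fun a => ConjClasses.mk (f (formOf a))) '' {a | Q a}) := by
  ext c
  constructor
  · rintro ⟨g, rfl, hg⟩
    rcases hreal g hg with ⟨A, rfl⟩ | h
    · right
      obtain ⟨a, ha⟩ := exists_isConj_formOf H A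
      have hc := (hf _ _).2 ha
      exact ⟨a, (hPQ a).1 (hP _ _ hc hg), (ConjClasses.mk_eq_mk_iff_isConj.2 hc).symm⟩
    · left
      exact ConjClasses.mk_eq_mk_iff_isConj.2 h
  · rintro (rfl | ⟨a, ha, rfl⟩)
    · exact ⟨w, rfl, hw⟩
    · exact ⟨_, rfl, (hPQ a).2 ha⟩

theorem ncard_classesContaining (H : IsOddLevelRing R ϖ ℓ q)
    (f : SpecialLinearGroup (Fin 2) R → G) (w : G)
    (hf : ∀ A B, IsConj (f A) (f B) ↔ IsConj A.val B.val) {P : G → Prop}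
    {Q : FormIndex ϖ ℓ → Prop} (hP : ∀ g h, IsConj g h → P g → P h)
    (hPQ : ∀ a, P (f (formOf a)) ↔ Q a) (hw : P w)
    (hreal : ∀ g, P g → (∃ A, g = f A) ∨ IsConj g w) (hfw : ∀ A, ¬ IsConj (f A) w) :
    (classesContaining P).ncard = {a | Q a}.ncard + 1 := by
  have := H.finite
  rw [classesContaining_eq H f w hf hP hPQ hw hreal, Set.ncard_insert_of_notMem,
    Set.ncard_image_of_injective]
  · intro a b hab
    exact formOf_injective H ((hf _ _).1 (ConjClasses.mk_eq_mk_iff_isConj.1 hab))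
  · rintro ⟨a, -, ha⟩
    exact hfw _ (ConjClasses.mk_eq_mk_iff_isConj.1 ha)

theorem isRealElement_of_isConj {g h : G} (hgh : IsConj g h) (hg : IsRealElement g) :
    IsRealElement h := by
  obtain ⟨c, rfl⟩ := isConj_iff.1 hgh
  obtain ⟨t, ht⟩ := hg
  refine ⟨c * t * c⁻¹, ?_⟩
  have : c * t * c⁻¹ * (c * g * c⁻¹) * (c * t * c⁻¹)⁻¹ = c * (t * g * t⁻¹) * c⁻¹ := by group
  rw [this, ht]
  group

theorem isStronglyRealElement_of_isConj {g h : G} (hgh : IsConj g h)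
    (hg : IsStronglyRealElement g) : IsStronglyRealElement h := by
  obtain ⟨c, rfl⟩ := isConj_iff.1 hgh
  obtain ⟨t, ht2, ht⟩ := hg
  refine ⟨c * t * c⁻¹, ?_, ?_⟩
  · rw [← ht2]
    exact orderOf_injective (MulAut.conj c).toMonoidHom (MulAut.conj c).injective t
  · have : c * t * c⁻¹ * (c * g * c⁻¹) * (c * t * c⁻¹)⁻¹ = c * (t * g * t⁻¹) * c⁻¹ := by group
    rw [this, ht]
    group

theorem isRealElement_of_isStronglyRealElement {g : G} (hg : IsStronglyRealElement g) :
    IsRealElement g := hg.imp fun _ h => h.2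

theorem classesContaining_inter {P Q : G → Prop} (hQ : ∀ g h, IsConj g h → Q g → Q h) :
    classesContaining P ∩ classesContaining Q = classesContaining fun g => P g ∧ Q g := by
  ext c
  constructor
  · rintro ⟨⟨g, rfl, hg⟩, h, hgh, hh⟩
    exact ⟨g, rfl, hg, hQ _ _ (ConjClasses.mk_eq_mk_iff_isConj.1 hgh) hh⟩
  · rintro ⟨g, rfl, hg, hh⟩
    exact ⟨⟨g, rfl, hg⟩, g, rfl, hh⟩

/-- The numbers of real, of real regular and of real non-regular classes of a group whose real
elements are, up to conjugation, parametrized by the similarity classes of matrices of determinant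
one and one further regular class. -/
theorem ncard_real_classes (H : IsOddLevelRing R ϖ ℓ q) (f : SpecialLinearGroup (Fin 2) R → G)
    (w : G) (reg : G → Prop)
    (hf : ∀ A B, IsConj (f A) (f B) ↔ IsConj A.val B.val)
    (hreal : ∀ g, IsRealElement g → (∃ A, g = f A) ∨ IsConj g w)
    (hfreal : ∀ A, IsRealElement (f A)) (hw : IsRealElement w) (hfw : ∀ A, ¬ IsConj (f A) w)
    (hreg : ∀ g h, IsConj g h → reg g → reg h)
    (hfreg : ∀ A, reg (f A) ↔ ¬ IsResiduallyScalar A.val) (hwreg : reg w) :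
    (realClasses G).ncard = 1 + q ^ ℓ + 2 * ∑ i ∈ Finset.range ℓ, q ^ i ∧
      (realClasses G ∩ classesContaining reg).ncard = q ^ ℓ + 1 ∧
      (realClasses G \ classesContaining reg).ncard = 2 * ∑ i ∈ Finset.range ℓ, q ^ i := by
  have := H.finite
  have h1 : (realClasses G).ncard = 1 + q ^ ℓ + 2 * ∑ i ∈ Finset.range ℓ, q ^ i := by
    have := ncard_classesContaining H f w hf (P := fun g => IsRealElement g) (Q := fun _ => True)
      (fun _ _ => isRealElement_of_isConj) (fun a => iff_of_true (hfreal _) trivial) hw hreal hfw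
    rw [realClasses, this, Set.ofPred_true, Set.ncard_univ, natCard_formIndex H]
    ring
  have h2 : (realClasses G ∩ classesContaining reg).ncard = q ^ ℓ + 1 := by
    rw [realClasses, classesContaining_inter hreg,
      ncard_classesContaining H f w hf (Q := fun a => a.isLeft = true)
        (fun _ _ h hg => ⟨isRealElement_of_isConj h hg.1, hreg _ _ h hg.2⟩) ?_ ⟨hw, hwreg⟩
        (fun g hg => hreal g hg.1) hfw]
    · have : {a : FormIndex ϖ ℓ | a.isLeft = true} = Set.range Sum.inl := by
        ext a
        rcases a with a | a <;> simp
      rw [this, ← Nat.card_coe_set_eq, Nat.card_range_of_injective Sum.inl_injective, H.natCard]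
    · rintro (y | a)
      · simpa using ⟨hfreal _, (hfreg _).2 (formOf_inl_not_isResiduallyScalar y)⟩
      · simpa [hfreg] using fun _ => formOf_inr_isResiduallyScalar H a
  refine ⟨h1, h2, ?_⟩
  have hfin : (realClasses G).Finite := Set.finite_of_ncard_ne_zero (by omega)
  have := Set.ncard_inter_add_ncard_sdiff_eq_ncard (realClasses G) (classesContaining reg) hfin
  omega

end NormalForm

/-! ### Regular matrices -/

/-- The minimal polynomial divides the quadratic characteristic polynomial, and it has degree one
exactly for scalar matrices. -/
theorem minpoly_eq_charpoly_iff {K : Type*} [Field K] (A : Matrix (Fin 2) (Fin 2) K) :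
    minpoly K A = A.charpoly ↔ ¬ ∃ k : K, A = k • 1 := by
  have hdeg : A.charpoly.natDegree = 2 := by
    rw [Matrix.charpoly_natDegree_eq_dim, Fintype.card_fin]
  have hint : IsIntegral K A := Matrix.isIntegral A
  constructor
  · rintro h ⟨k, hk⟩
    have hdvd : minpoly K A ∣ Polynomial.X - Polynomial.C k := minpoly.dvd _ _ (by
      rw [map_sub, Polynomial.aeval_X, Polynomial.aeval_C, hk, Algebra.algebraMap_eq_smul_one,
        sub_self])
    have := Polynomial.natDegree_le_of_dvd hdvd (Polynomial.X_sub_C_ne_zero k)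
    rw [h, hdeg, Polynomial.natDegree_X_sub_C] at this
    omega
  · intro h
    refine (Polynomial.eq_of_monic_of_dvd_of_natDegree_le (minpoly.monic hint)
      (Matrix.charpoly_monic A) (Matrix.minpoly_dvd_charpoly A) ?_).symm
    rw [hdeg]
    by_contra! hlt
    have hpos := minpoly.natDegree_pos hint
    have h1 : (minpoly K A).natDegree = 1 := by omega
    have h2 := (minpoly.monic hint).eq_X_add_C h1
    have h3 := minpoly.aeval K A
    rw [h2, map_add, Polynomial.aeval_X, Polynomial.aeval_C, Algebra.algebraMap_eq_smul_one] at h3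
    exact h ⟨_, by rw [eq_neg_of_add_eq_zero_left h3, neg_smul]⟩

theorem isRegularMatrix_iff {R : Type*} [CommRing R] [IsLocalRing R] {ℓ : ℕ} (hℓ : 1 ≤ ℓ)
    [IsLocalRing (LevelRing R ℓ)] (A : Matrix (Fin 2) (Fin 2) (LevelRing R ℓ)) :
    IsRegularMatrix hℓ A ↔ ¬ IsResiduallyScalar A := by
  have hsurj : Function.Surjective (levelReduction R hℓ) := fun x => by
    obtain ⟨y, rfl⟩ := residue_surjective x
    exact ⟨Ideal.Quotient.mk _ y, rfl⟩
  have hker : ∀ x, x ∈ maximalIdeal (LevelRing R ℓ) ↔ levelReduction R hℓ x = 0 := by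
    intro x
    rw [← IsLocalRing.eq_maximalIdeal (RingHom.ker_isMaximal_of_surjective _ hsurj),
      RingHom.mem_ker]
  rw [IsRegularMatrix, minpoly_eq_charpoly_iff, not_iff_not]
  simp only [IsResiduallyScalar, hker, map_sub, sub_eq_zero]
  constructor
  · rintro ⟨k, hk⟩
    have h := fun i j => congrFun (congrFun hk i) j
    simp only [Matrix.map_apply] at h
    simp [h]
  · rintro ⟨h1, h2, h3⟩
    refine ⟨levelReduction R hℓ (A 1 1), ?_⟩
    ext i j
    fin_cases i <;> fin_cases j <;> simp [h1, h2, h3]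

/-! ### The general linear group -/

section GeneralLinear

variable {R : Type*} [CommRing R]

theorem isConj_iff_isConj_val {g h : GL (Fin 2) R} : IsConj g h ↔ IsConj g.val h.val := by
  rw [isConj_iff]
  constructor
  · rintro ⟨c, rfl⟩
    refine ⟨c, ?_⟩
    rw [SemiconjBy, ← Units.val_mul, ← Units.val_mul, inv_mul_cancel_right]
  · rintro ⟨c, hc⟩
    exact ⟨c, by rw [mul_inv_eq_iff_eq_mul]; exact Units.ext hc.eq⟩

theorem GL_inv_val_eq {g : GL (Fin 2) R} {d : R} (hd : d * g.val.det = 1) :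
    (g⁻¹).val = d • g.val.adjugate := by
  have h : g.val * (d • g.val.adjugate) = 1 := by
    rw [Matrix.mul_smul, Matrix.mul_adjugate, smul_smul, hd, one_smul]
  rw [← Matrix.one_mul (d • g.val.adjugate), ← Units.inv_mul g, Matrix.mul_assoc, h,
    Matrix.mul_one]

/-- Similarity preserves determinant and trace, and once d² = 1 the inverse is d·adj g, of trace
d·tr g. -/
theorem det_trace_of_isConj_inv {g : GL (Fin 2) R} (hg : IsConj g.val (g⁻¹).val) :
    g.val.det * g.val.det = 1 ∧ g.val.trace = g.val.det * g.val.trace := by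
  have h1 := Matrix.det_eq_of_isConj hg
  have h2 : g.val.det * (g⁻¹).val.det = 1 := by
    rw [← Matrix.det_mul, Units.mul_inv, Matrix.det_one]
  rw [← h1] at h2
  refine ⟨h2, ?_⟩
  conv_lhs => rw [Matrix.trace_eq_of_isConj hg, GL_inv_val_eq h2]
  simp only [Matrix.adjugate_fin_two, Matrix.trace_fin_two, Matrix.smul_apply, smul_eq_mul]
  simp
  ring

theorem trace_eq_zero_of_eq_neg (h2 : IsUnit (2 : R)) {x : R} (hx : x = -x) : x = 0 := by
  refine h2.mul_right_eq_zero.1 ?_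
  linear_combination hx

theorem det_weylMatrix : (weylMatrix R).det = -1 := by
  simp [weylMatrix]

theorem trace_weylMatrix : (weylMatrix R).trace = 0 := by
  simp [weylMatrix, Matrix.trace_fin_two]

variable [IsLocalRing R] {ϖ : R} {ℓ q : ℕ}

/-- Trace zero and congruent diagonal entries put twice a diagonal entry in m, hence also the
determinant. -/
theorem not_isResiduallyScalar_of_trace_eq_zero (h2 : IsUnit (2 : R))
    {A : Matrix (Fin 2) (Fin 2) R} (ht : A.trace = 0) (hd : IsUnit A.det) :
    ¬ IsResiduallyScalar A := by
  rintro ⟨h01, -, h⟩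
  refine (mem_maximalIdeal _).1 ?_ hd
  have h11 : A 1 1 ∈ maximalIdeal R := by
    refine (Ideal.unit_mul_mem_iff_mem _ h2).1 ?_
    have := neg_mem h
    rw [Matrix.trace_fin_two] at ht
    convert this using 1
    linear_combination ht
  rw [Matrix.det_fin_two]
  exact sub_mem (Ideal.mul_mem_left _ _ h11) (Ideal.mul_mem_right _ _ h01)

/-- The Weyl element of `GL₂`. -/
def weylGL (R : Type*) [CommRing R] : GL (Fin 2) R :=
  ⟨weylMatrix R, weylMatrix R, weylMatrix_mul_self R, weylMatrix_mul_self R⟩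

theorem one_ne_neg_one (h2 : IsUnit (2 : R)) : (1 : R) ≠ -1 := fun h =>
  one_ne_zero (trace_eq_zero_of_eq_neg h2 h)

theorem ncard_real_classes_GL (H : IsOddLevelRing R ϖ ℓ q) (reg : GL (Fin 2) R → Prop)
    (hreg : ∀ g, reg g ↔ ¬ IsResiduallyScalar g.val) :
    (realClasses (GL (Fin 2) R)).ncard = 1 + q ^ ℓ + 2 * ∑ i ∈ Finset.range ℓ, q ^ i ∧
      (realClasses (GL (Fin 2) R) ∩ classesContaining reg).ncard = q ^ ℓ + 1 ∧
      (realClasses (GL (Fin 2) R) \ classesContaining reg).ncard =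
        2 * ∑ i ∈ Finset.range ℓ, q ^ i := by
  have hval : ∀ A : SpecialLinearGroup (Fin 2) R, (SpecialLinearGroup.toGL A).val = A.val :=
    fun _ => rfl
  have hreal : ∀ g : GL (Fin 2) R, IsRealElement g → IsConj g.val (g⁻¹).val := fun g hg =>
    isConj_iff_isConj_val.1 (isConj_iff.2 hg)
  have hW : ¬ IsResiduallyScalar (weylGL R).val :=
    not_isResiduallyScalar_of_trace_eq_zero H.isUnit_two trace_weylMatrix
      (det_weylMatrix (R := R) ▸ isUnit_one.neg)
  refine ncard_real_classes H (fun A => SpecialLinearGroup.toGL A) (weylGL R) reg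
    (fun A B => isConj_iff_isConj_val) ?_ ?_ ⟨1, ?_⟩ ?_ ?_ (fun A => hreg _) ((hreg _).2 hW)
  · intro g hg
    obtain ⟨h1, h2⟩ := det_trace_of_isConj_inv (hreal g hg)
    rcases eq_one_or_neg_one_of_sq_eq_one H.isUnit_two h1 with h | h
    · exact Or.inl ⟨⟨g.val, h⟩, Units.ext rfl⟩
    · right
      rw [h, neg_one_mul] at h2
      have ht := trace_eq_zero_of_eq_neg H.isUnit_two h2
      rw [isConj_iff_isConj_val]
      refine isConj_of_trace_det (not_isResiduallyScalar_of_trace_eq_zero H.isUnit_two ht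
        (h ▸ isUnit_one.neg)) hW (ht.trans trace_weylMatrix.symm) (h.trans det_weylMatrix.symm)
  · intro A
    refine isConj_iff.1 (isConj_iff_isConj_val.2 ?_)
    rw [GL_inv_val_eq (d := 1) (by rw [hval, A.2, one_mul]), one_smul]
    exact isConj_adjugate H A
  · rw [one_mul, inv_one, mul_one]
    rfl
  · intro A h
    have := Matrix.det_eq_of_isConj (isConj_iff_isConj_val.1 h)
    rw [hval, A.2] at this
    exact one_ne_neg_one H.isUnit_two (this.trans det_weylMatrix)
  · intro g h hgh hg
    rw [hreg] at hg ⊢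
    exact fun hh => hg (isResiduallyScalar_of_isConj (isConj_iff_isConj_val.1 hgh.symm) hh)

end GeneralLinear

/-- The preimage of a subgroup under conjugation is isomorphic to the subgroup. -/
def Subgroup.comapConjEquiv {G : Type*} [Group G] (U : Subgroup G) (d : G) :
    U.comap (MulAut.conj d).toMonoidHom ≃* U where
  toFun g := ⟨d * g.val * d⁻¹, g.2⟩
  invFun u := ⟨d⁻¹ * u.val * d, by
    change d * (d⁻¹ * u.val * d) * d⁻¹ ∈ U
    convert u.2 using 1
    group⟩
  left_inv g := Subtype.ext (by group)
  right_inv u := Subtype.ext (by group)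
  map_mul' g h := Subtype.ext (by simp only [Subgroup.coe_mul]; group)

/-! ### Quadratic extensions with an anti-invariant square root -/

/-- `S` is the extension of the local ring `R` by a square root `ε` of a unit `η` that is not a
square in the residue field, and `c` is its conjugation. -/
structure IsInertExtension {R S : Type*} [CommRing R] [IsLocalRing R] [CommRing S]
    (ι : R →+* S) (c : S →+* S) (ε : Sˣ) (η : Rˣ) : Prop where
  mul_self : (ε : S) * ε = ι η
  conj_root : c ε = -ε
  conj_map : ∀ a, c (ι a) = ι a
  exists_eq : ∀ x, ∃ a b, x = ι a + ι b * ε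
  eq_zero : ∀ a b, ι a + ι b * ε = 0 → a = 0 ∧ b = 0
  sq_sub_notMem : ∀ a : R, a * a - ((η⁻¹ : Rˣ) : R) ∉ maximalIdeal R

namespace IsInertExtension

theorem det_map {R S : Type*} [CommRing R] [CommRing S] (ι : R →+* S) (A : Matrix (Fin 2) (Fin 2) R) : (A.map ι).det = ι A.det :=
  (RingHom.map_det ι A).symm

variable {R S : Type*} [CommRing R] [IsLocalRing R] [CommRing S]
  {ι : R →+* S} {c : S →+* S} {ε : Sˣ} {η : Rˣ}

theorem injective (E : IsInertExtension ι c ε η) : Function.Injective ι := by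
  rw [injective_iff_map_eq_zero]
  intro a ha
  exact (E.eq_zero a 0 (by rw [ha, map_zero, zero_mul, add_zero])).1

theorem isUnit_of_map (E : IsInertExtension ι c ε η) {a : R} (h : IsUnit (ι a)) : IsUnit a := by
  obtain ⟨x, hx⟩ := h.exists_right_inv
  obtain ⟨b, d, rfl⟩ := E.exists_eq x
  refine IsUnit.of_mul_eq_one b (sub_eq_zero.1 (E.eq_zero (a * b - 1) (a * d) ?_).1)
  rw [map_sub, map_mul, map_mul, map_one]
  linear_combination hx

theorem eq_map_of_conj_eq (E : IsInertExtension ι c ε η) (h2 : IsUnit (2 : R)) {x : S}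
    (hx : c x = x) : ∃ a, x = ι a := by
  obtain ⟨a, b, rfl⟩ := E.exists_eq x
  have h := (E.eq_zero 0 (2 * b) (by
    rw [map_add, map_mul, E.conj_map, E.conj_map, E.conj_root] at hx
    rw [map_zero, map_mul, map_ofNat]
    linear_combination -hx)).2
  rw [h2.mul_right_eq_zero.1 h]
  exact ⟨a, by rw [map_zero, zero_mul, add_zero]⟩

theorem eq_mul_of_conj_eq_neg (E : IsInertExtension ι c ε η) (h2 : IsUnit (2 : R)) {x : S}
    (hx : c x = -x) : ∃ a, x = ε * ι a := by
  obtain ⟨a, b, rfl⟩ := E.exists_eq x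
  have h := (E.eq_zero (2 * a) 0 (by
    rw [map_add, map_mul, E.conj_map, E.conj_map, E.conj_root] at hx
    rw [map_zero, map_mul, map_ofNat]
    linear_combination hx)).1
  rw [h2.mul_right_eq_zero.1 h]
  exact ⟨b, by rw [map_zero, zero_add, mul_comm]⟩

theorem matrix_eq_map_of_conj_eq (E : IsInertExtension ι c ε η) (h2 : IsUnit (2 : R))
    {M : Matrix (Fin 2) (Fin 2) S} (hM : M.map c = M) :
    ∃ A : Matrix (Fin 2) (Fin 2) R, M = A.map ι := by
  choose A hA using fun i j => E.eq_map_of_conj_eq h2 (congrFun (congrFun hM i) j)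
  exact ⟨Matrix.of A, Matrix.ext hA⟩

theorem matrix_eq_smul_of_conj_eq_neg (E : IsInertExtension ι c ε η) (h2 : IsUnit (2 : R))
    {M : Matrix (Fin 2) (Fin 2) S} (hM : M.map c = -M) :
    ∃ A : Matrix (Fin 2) (Fin 2) R, M = (ε : S) • A.map ι := by
  choose A hA using fun i j => E.eq_mul_of_conj_eq_neg h2 (congrFun (congrFun hM i) j)
  exact ⟨Matrix.of A, Matrix.ext hA⟩

theorem map_matrix_injective (E : IsInertExtension ι c ε η) {A B : Matrix (Fin 2) (Fin 2) R}
    (h : A.map ι = B.map ι) : A = B :=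
  Matrix.map_injective E.injective h

/-! ### The twisted unitary group -/

/-- The diagonal matrix with entries `ε` and `1`. -/
def diagonalUnit (ε : Sˣ) : GL (Fin 2) S :=
  ⟨!![(ε : S), 0; 0, 1], !![((ε⁻¹ : Sˣ) : S), 0; 0, 1], by
    ext i j; fin_cases i <;> fin_cases j <;> simp [Matrix.mul_apply], by
    ext i j; fin_cases i <;> fin_cases j <;> simp [Matrix.mul_apply]⟩

/-- The conjugate of the unitary group by a diagonal matrix that contains `SL₂(R)`. -/
noncomputable def twistedUnitary (c : S →+* S) (ε : Sˣ) : Subgroup (GL (Fin 2) S) :=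
  (unitaryGroupTwo c).comap (MulAut.conj (diagonalUnit ε)).toMonoidHom

/-- The twisted unitary group is isomorphic to the unitary group. -/
noncomputable def twistedUnitaryEquiv (c : S →+* S) (ε : Sˣ) :
    twistedUnitary c ε ≃* unitaryGroupTwo c :=
  (unitaryGroupTwo c).comapConjEquiv (diagonalUnit ε)

theorem conj_root_inv (E : IsInertExtension ι c ε η) : c ((ε⁻¹ : Sˣ) : S) = -((ε⁻¹ : Sˣ) : S) := by
  have h := congrArg c (Units.mul_inv ε)
  rw [map_mul, E.conj_root, map_one] at h
  have := Units.mul_inv ε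
  linear_combination (-((ε⁻¹ : Sˣ) : S)) * h - (c ((ε⁻¹ : Sˣ) : S)) * this

theorem diagonalUnit_conj (ε : Sˣ) (M : Matrix (Fin 2) (Fin 2) S) :
    (diagonalUnit ε).val * M * ((diagonalUnit ε)⁻¹).val =
      !![M 0 0, ε * M 0 1; M 1 0 * ((ε⁻¹ : Sˣ) : S), M 1 1] := by
  have h := Units.mul_inv ε
  change !![(ε : S), 0; 0, 1] * M * !![((ε⁻¹ : Sˣ) : S), 0; 0, 1] = _
  rw [Matrix.eta_fin_two M, Matrix.mul_fin_two, Matrix.mul_fin_two]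
  ext i j
  fin_cases i <;> fin_cases j <;> simp
  linear_combination M 0 0 * h

theorem starMatrix_fin_two (a b d e : S) :
    starMatrix c !![a, b; d, e] = !![c e, c b; c d, c a] := by
  rw [starMatrix, weylMatrix_inv]
  have h : ((!![a, b; d, e] : Matrix (Fin 2) (Fin 2) S).map c)ᵀ = !![c a, c d; c b, c e] := by
    ext i j
    fin_cases i <;> fin_cases j <;> rfl
  rw [h, weylMatrix, Matrix.mul_fin_two, Matrix.mul_fin_two]
  simp

/-- The operation ⋆ differs from the adjugate of the conjugate only by the signs of the off-diagonal
entries; conjugation by diag(ε, 1) absorbs them because c(ε) = -ε. -/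
theorem starMatrix_conj (E : IsInertExtension ι c ε η) (M : Matrix (Fin 2) (Fin 2) S) :
    starMatrix c ((diagonalUnit ε).val * M * ((diagonalUnit ε)⁻¹).val) =
      (diagonalUnit ε).val * (M.map c).adjugate * ((diagonalUnit ε)⁻¹).val := by
  rw [diagonalUnit_conj, diagonalUnit_conj, starMatrix_fin_two, Matrix.adjugate_fin_two]
  ext i j
  fin_cases i <;> fin_cases j <;> simp [E.conj_root, E.conj_root_inv]

theorem mem_twistedUnitary (E : IsInertExtension ι c ε η) {g : GL (Fin 2) S} :
    g ∈ twistedUnitary c ε ↔ (g.val.map c).adjugate * g.val = 1 := by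
  change starMatrix c ((diagonalUnit ε).val * g.val * ((diagonalUnit ε)⁻¹).val) *
    ((diagonalUnit ε).val * g.val * ((diagonalUnit ε)⁻¹).val) = 1 ↔ _
  rw [starMatrix_conj E]
  have : (diagonalUnit ε).val * (g.val.map c).adjugate * ((diagonalUnit ε)⁻¹).val *
      ((diagonalUnit ε).val * g.val * ((diagonalUnit ε)⁻¹).val) =
      (diagonalUnit ε).val * ((g.val.map c).adjugate * g.val) * ((diagonalUnit ε)⁻¹).val := by
    simp only [Matrix.mul_assoc]
    rw [← Matrix.mul_assoc ((diagonalUnit ε)⁻¹).val, Units.inv_mul, Matrix.one_mul]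
  rw [this]
  constructor
  · intro h
    have h' := congrArg (fun M => ((diagonalUnit ε)⁻¹).val * M * (diagonalUnit ε).val) h
    simp only [Matrix.mul_assoc, Units.inv_mul, Matrix.mul_one] at h'
    rwa [← Matrix.mul_assoc, Units.inv_mul, Matrix.one_mul] at h'
  · intro h
    rw [h, Matrix.mul_one, Units.mul_inv]

/-- Multiplying the defining equation by c(g) shows that conjugation acts on g as a scalar; for
determinant ±1 this makes g, or g divided by ε, a matrix over R. -/
theorem mem_twistedUnitary_iff (E : IsInertExtension ι c ε η) {g : GL (Fin 2) S} :
    g ∈ twistedUnitary c ε ↔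
      c g.val.det * g.val.det = 1 ∧ g.val.map c = c g.val.det • g.val := by
  have hc : (g.val.map c).det = c g.val.det := (RingHom.map_det c g.val).symm
  rw [E.mem_twistedUnitary]
  constructor
  · intro h
    have hd : c g.val.det * g.val.det = 1 := by
      have := congrArg Matrix.det h
      rwa [Matrix.det_mul, Matrix.det_one, Matrix.adjugate_fin_two, Matrix.det_fin_two_of,
        show (g.val.map c) 1 1 * (g.val.map c) 0 0 - -(g.val.map c) 0 1 * -(g.val.map c) 1 0 =
          (g.val.map c).det by rw [Matrix.det_fin_two]; ring, hc] at this
    refine ⟨hd, ?_⟩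
    have := congrArg (fun M => g.val.map c * M) h
    simp only [← Matrix.mul_assoc, Matrix.mul_adjugate, Matrix.smul_mul, Matrix.one_mul,
      Matrix.mul_one, hc] at this
    exact this.symm
  · rintro ⟨hd, h⟩
    have hg : g.val = g.val.det • g.val.map c := by
      rw [h, smul_smul, mul_comm, hd, one_smul]
    calc (g.val.map c).adjugate * g.val = (g.val.map c).adjugate * (g.val.det • g.val.map c) := by
          rw [← hg]
      _ = 1 := by
          rw [Matrix.mul_smul, Matrix.adjugate_mul, hc, smul_smul, mul_comm, hd, one_smul]

/-- From d² = 1 = c(d)d follows c(d) = d, so d comes from R, where the equation is solved. -/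
theorem det_eq_one_or_neg_one (E : IsInertExtension ι c ε η) (h2 : IsUnit (2 : R))
    {g : GL (Fin 2) S} (hg : g ∈ twistedUnitary c ε) (hd : g.val.det * g.val.det = 1) :
    g.val.det = 1 ∨ g.val.det = -1 := by
  obtain ⟨h1, -⟩ := E.mem_twistedUnitary_iff.1 hg
  obtain ⟨a, ha⟩ := E.eq_map_of_conj_eq h2 (x := g.val.det)
    (by linear_combination g.val.det * h1 - c g.val.det * hd)
  rw [ha, ← map_mul, ← map_one ι] at hd
  rw [ha]
  rcases eq_one_or_neg_one_of_sq_eq_one h2 (E.injective hd) with rfl | rfl <;> simp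

theorem exists_eq_map_of_det_eq_one (E : IsInertExtension ι c ε η) (h2 : IsUnit (2 : R))
    {g : GL (Fin 2) S} (hg : g ∈ twistedUnitary c ε) (hd : g.val.det = 1) :
    ∃ A : SpecialLinearGroup (Fin 2) R, g.val = A.val.map ι := by
  obtain ⟨-, h⟩ := E.mem_twistedUnitary_iff.1 hg
  rw [hd, map_one, one_smul] at h
  obtain ⟨A, hA⟩ := E.matrix_eq_map_of_conj_eq h2 h
  refine ⟨⟨A, E.injective ?_⟩, hA⟩
  rw [← det_map ι, ← hA, hd, map_one]

theorem exists_eq_smul_of_det_eq_neg_one (E : IsInertExtension ι c ε η) (h2 : IsUnit (2 : R))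
    {g : GL (Fin 2) S} (hg : g ∈ twistedUnitary c ε) (hd : g.val.det = -1) :
    ∃ A : Matrix (Fin 2) (Fin 2) R, g.val = (ε : S) • A.map ι ∧ (η : R) * A.det = -1 := by
  obtain ⟨-, h⟩ := E.mem_twistedUnitary_iff.1 hg
  rw [hd, map_neg, map_one, neg_one_smul] at h
  obtain ⟨A, hA⟩ := E.matrix_eq_smul_of_conj_eq_neg h2 h
  refine ⟨A, hA, E.injective ?_⟩
  rw [map_mul, ← det_map ι, ← E.mul_self, map_neg, map_one, ← hd, hA, Matrix.det_smul,
    Fintype.card_fin, sq]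

theorem mem_twistedUnitary_of_eq_smul_map (E : IsInertExtension ι c ε η) {g : GL (Fin 2) S}
    {μ : S} {A : Matrix (Fin 2) (Fin 2) R} (hg : g.val = μ • A.map ι)
    (h : c μ * μ * ι A.det = 1) : g ∈ twistedUnitary c ε := by
  have hc : (A.map ι).map c = A.map ι := by
    ext i j
    exact E.conj_map _
  have hadj : g.val.map c = c μ • A.map ι := by
    rw [← hc, hg]
    ext i j
    simp [E.conj_map]
  rw [E.mem_twistedUnitary, hadj, hg, Matrix.adjugate_smul, Matrix.smul_mul, Matrix.mul_smul,
    Matrix.adjugate_mul, smul_smul, smul_smul, det_map, Fintype.card_fin]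
  simp only [Nat.reduceSub, pow_one]
  rw [h, one_smul]

theorem exists_norm_eq [Finite R] (E : IsInertExtension ι c ε η) (h2 : IsUnit (2 : R)) {v : R}
    (hv : IsUnit v) : ∃ μ : S, c μ * μ = ι v := by
  obtain ⟨a, b, h⟩ := exists_sq_sub_mul_sq_eq h2 η.isUnit hv
  refine ⟨ι a + ι b * ε, ?_⟩
  rw [map_add, map_mul, E.conj_map, E.conj_map, E.conj_root, ← h, map_sub, map_mul, map_mul,
    map_mul, ← E.mul_self]
  ring

/-- Similar matrices over `R` are similar under the twisted unitary group. -/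
theorem exists_mem_twistedUnitary_of_isConj [Finite R] (E : IsInertExtension ι c ε η)
    (h2 : IsUnit (2 : R)) {A B : Matrix (Fin 2) (Fin 2) R} (h : IsConj A B) :
    ∃ g ∈ twistedUnitary c ε, g.val * A.map ι = B.map ι * g.val := by
  obtain ⟨h, hh⟩ := h
  have hdet : IsUnit h.val.det := (Matrix.isUnit_iff_isUnit_det _).1 h.isUnit
  obtain ⟨v, hv⟩ := hdet.exists_right_inv
  -- A scalar does not disturb the intertwining relation; one of norm (det h)⁻¹ makes h unitary.
  obtain ⟨μ, hμ⟩ := E.exists_norm_eq h2 (IsUnit.of_mul_eq_one h.val.det (by rwa [mul_comm]) :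
    IsUnit v)
  have hN : c μ * μ * ι h.val.det = 1 := by rw [hμ, ← map_mul, mul_comm, hv, map_one]
  have hu : IsUnit (μ • h.val.map ι) := by
    rw [Matrix.isUnit_iff_isUnit_det, Matrix.det_smul, det_map]
    exact ((IsUnit.of_mul_eq_one (c μ * ι h.val.det) (by linear_combination hN)).pow _).mul
      (hdet.map ι)
  refine ⟨hu.unit, E.mem_twistedUnitary_of_eq_smul_map rfl hN, ?_⟩
  rw [IsUnit.unit_spec, Matrix.smul_mul, Matrix.mul_smul, ← Matrix.map_mul, ← Matrix.map_mul, hh.eq]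

theorem isConj_of_intertwining (E : IsInertExtension ι c ε η) {g : GL (Fin 2) S}
    {A B M : Matrix (Fin 2) (Fin 2) R} {k μ : S} (hk : IsUnit k) (hμ : IsUnit μ)
    (h : k • M.map ι = μ • g.val) (hg : g.val * A.map ι = B.map ι * g.val) : IsConj A B := by
  have hM : IsUnit M := by
    rw [Matrix.isUnit_iff_isUnit_det]
    refine E.isUnit_of_map ?_
    have hd := congrArg Matrix.det h
    rw [Matrix.det_smul, Matrix.det_smul, det_map] at hd
    have hu : IsUnit (k ^ Fintype.card (Fin 2) * ι M.det) := by
      rw [hd]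
      exact (hμ.pow _).mul ((Matrix.isUnit_iff_isUnit_det _).1 g.isUnit)
    exact isUnit_of_mul_isUnit_right hu
  refine ⟨hM.unit, E.map_matrix_injective ?_⟩
  rw [IsUnit.unit_spec, Matrix.map_mul, Matrix.map_mul]
  have h1 : k • (M.map ι * A.map ι) = k • (B.map ι * M.map ι) := by
    rw [← Matrix.smul_mul, ← Matrix.mul_smul, h, Matrix.smul_mul, Matrix.mul_smul, hg]
  exact hk.smul_left_cancel.1 h1

/-- Matrices over `R` that are similar under the twisted unitary group are similar over `R`. -/
theorem isConj_of_mem_twistedUnitary [IsLocalRing S] (E : IsInertExtension ι c ε η)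
    (h2 : IsUnit (2 : R)) {g : GL (Fin 2) S} (hg : g ∈ twistedUnitary c ε)
    {A B : Matrix (Fin 2) (Fin 2) R} (h : g.val * A.map ι = B.map ι * g.val) : IsConj A B := by
  obtain ⟨hd, hc⟩ := E.mem_twistedUnitary_iff.1 hg
  have hcc : ∀ x, c (c x) = x := fun x => by
    obtain ⟨a, b, rfl⟩ := E.exists_eq x
    simp only [map_add, map_mul, map_neg, E.conj_map, E.conj_root]
    ring
  have hc' : (g.val.map c).map c = g.val := by
    ext i j
    exact hcc _
  -- Here g ± c(g) = (1 ± c(det g))·g. The two factors add up to 2, so one is a unit, and the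
  -- corresponding combination is invariant or anti-invariant, hence comes from R up to the factor
  -- ε.
  have hu : IsUnit ((1 + c g.val.det) + (1 - c g.val.det)) := by
    have : (1 + c g.val.det) + (1 - c g.val.det) = ι 2 := by
      rw [map_ofNat]
      ring
    rw [this]
    exact h2.map ι
  rcases isUnit_or_isUnit_of_isUnit_add hu with h1 | h1
  · obtain ⟨M, hM⟩ := E.matrix_eq_map_of_conj_eq h2 (M := g.val + g.val.map c) (by
      rw [Matrix.map_add c (map_add c), hc', add_comm])
    refine E.isConj_of_intertwining (M := M) isUnit_one h1 ?_ h
    rw [one_smul, ← hM, hc, add_smul, one_smul]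
  · obtain ⟨M, hM⟩ := E.matrix_eq_smul_of_conj_eq_neg h2 (M := g.val - g.val.map c) (by
      rw [Matrix.map_sub c (map_sub c), hc', neg_sub])
    refine E.isConj_of_intertwining (M := M) ε.isUnit h1 ?_ h
    rw [← hM, hc, sub_smul, one_smul]

/-- The embedding of `SL₂(R)` into the twisted unitary group. -/
noncomputable def ofSL (E : IsInertExtension ι c ε η) (A : SpecialLinearGroup (Fin 2) R) :
    twistedUnitary c ε :=
  ⟨SpecialLinearGroup.toGL (A.map ι), E.mem_twistedUnitary_of_eq_smul_map (μ := 1) (A := A.val)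
    (by rw [one_smul]; rfl) (by rw [A.2]; simp)⟩

theorem ofSL_val (E : IsInertExtension ι c ε η) (A : SpecialLinearGroup (Fin 2) R) :
    (E.ofSL A).val.val = A.val.map ι :=
  rfl

theorem twistedUnitary_ext {g h : twistedUnitary c ε} (hgh : g.val.val = h.val.val) : g = h :=
  Subtype.ext (Units.ext hgh)

theorem isConj_ofSL_iff [Finite R] [IsLocalRing S] (E : IsInertExtension ι c ε η)
    (h2 : IsUnit (2 : R)) (A B : SpecialLinearGroup (Fin 2) R) :
    IsConj (E.ofSL A) (E.ofSL B) ↔ IsConj A.val B.val := by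
  rw [isConj_iff]
  constructor
  · rintro ⟨g, hg⟩
    rw [mul_inv_eq_iff_eq_mul] at hg
    exact E.isConj_of_mem_twistedUnitary h2 g.2 (congrArg (fun x => x.val.val) hg)
  · intro h
    obtain ⟨g, hg, hgA⟩ := E.exists_mem_twistedUnitary_of_isConj h2 h
    refine ⟨⟨g, hg⟩, ?_⟩
    rw [mul_inv_eq_iff_eq_mul]
    exact twistedUnitary_ext hgA

theorem ofSL_inv (E : IsInertExtension ι c ε η) (A : SpecialLinearGroup (Fin 2) R) :
    (E.ofSL A)⁻¹ = E.ofSL A⁻¹ := by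
  refine inv_eq_of_mul_eq_one_right (twistedUnitary_ext ?_)
  have h : A.val * (A⁻¹).val = 1 := congrArg Subtype.val (mul_inv_cancel A)
  change A.val.map ι * (A⁻¹).val.map ι = 1
  rw [← Matrix.map_mul, h, Matrix.map_one _ (map_zero _) (map_one _)]

/-- The element of the twisted unitary group attached to a matrix `A` with `η * det A = -1`. -/
noncomputable def ofNegDet (E : IsInertExtension ι c ε η) (A : Matrix (Fin 2) (Fin 2) R)
    (hA : (η : R) * A.det = -1) : twistedUnitary c ε :=
  have h : ((ε : S) • A.map ι).det = -1 := by
    rw [Matrix.det_smul, det_map, Fintype.card_fin, sq, E.mul_self, ← map_mul, hA, map_neg, map_one]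
  ⟨((Matrix.isUnit_iff_isUnit_det ((ε : S) • A.map ι)).2 (h ▸ isUnit_one.neg)).unit,
    E.mem_twistedUnitary_of_eq_smul_map (μ := ε) (A := A) rfl (by
      rw [E.conj_root, neg_mul, E.mul_self, neg_mul, ← map_mul, hA, map_neg, map_one, neg_neg])⟩

theorem ofNegDet_val (E : IsInertExtension ι c ε η) (A : Matrix (Fin 2) (Fin 2) R)
    (hA : (η : R) * A.det = -1) : (E.ofNegDet A hA).val.val = (ε : S) • A.map ι :=
  rfl

/-- By Cayley–Hamilton a traceless A satisfies A² = -det A, so (εA)² = -η·det A = 1. -/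
theorem ofNegDet_mul_self (E : IsInertExtension ι c ε η) {A : Matrix (Fin 2) (Fin 2) R}
    (hA : (η : R) * A.det = -1) (ht : A.trace = 0) :
    E.ofNegDet A hA * E.ofNegDet A hA = 1 := by
  refine twistedUnitary_ext ?_
  change ((ε : S) • A.map ι) * ((ε : S) • A.map ι) = 1
  have hsq : A * A = (-A.det) • 1 := by
    rw [Matrix.trace_fin_two] at ht
    ext i j
    fin_cases i <;> fin_cases j <;> simp [Matrix.mul_apply, Fin.sum_univ_two, Matrix.det_fin_two]
    · linear_combination A 0 0 * ht
    · linear_combination A 0 1 * ht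
    · linear_combination A 1 0 * ht
    · linear_combination A 1 1 * ht
  rw [Matrix.smul_mul, Matrix.mul_smul, smul_smul, E.mul_self, ← Matrix.map_mul, hsq]
  ext i j
  have h1 : ι η * ι A.det = -1 := by rw [← map_mul, hA, map_neg, map_one]
  fin_cases i <;> fin_cases j <;> simp [h1]

end IsInertExtension

/-! ### Inversion by traceless matrices and the resulting quadratic equation. -/

section StronglyReal

variable {R : Type*} [CommRing R]

/-- Here (tr A)² = tr A² + 2 det A = 4, so the trace is a unit; it annihilates the off-diagonal
entries and the difference of the diagonal ones. -/
theorem eq_one_or_neg_one_of_mul_self_eq_one [IsLocalRing R] (h2 : IsUnit (2 : R))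
    {A : Matrix (Fin 2) (Fin 2) R} (hd : A.det = 1) (hA : A * A = 1) : A = 1 ∨ A = -1 := by
  have h00 := congrFun (congrFun hA 0) 0
  have h01 := congrFun (congrFun hA 0) 1
  have h10 := congrFun (congrFun hA 1) 0
  have h11 := congrFun (congrFun hA 1) 1
  simp only [Matrix.mul_apply, Fin.sum_univ_two, Matrix.one_apply_eq,
    Matrix.one_apply_ne zero_ne_one, Matrix.one_apply_ne one_ne_zero] at h00 h01 h10 h11
  rw [Matrix.det_fin_two] at hd
  have ht : IsUnit (A 0 0 + A 1 1) := by
    refine isUnit_of_mul_isUnit_left (y := A 0 0 + A 1 1) ?_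
    have : (A 0 0 + A 1 1) * (A 0 0 + A 1 1) = 2 * 2 := by linear_combination h00 + h11 + 2 * hd
    rw [this]
    exact h2.mul h2
  have e01 : A 0 1 = 0 := ht.mul_right_eq_zero.1 (by linear_combination h01)
  have e10 : A 1 0 = 0 := ht.mul_right_eq_zero.1 (by linear_combination h10)
  have e11 : A 0 0 = A 1 1 := by
    refine sub_eq_zero.1 (ht.mul_right_eq_zero.1 ?_)
    linear_combination h00 - h11
  rw [e01, e10, e11] at h00
  rcases eq_one_or_neg_one_of_sq_eq_one h2 (x := A 1 1) (by linear_combination h00) with h | h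
  · left
    ext i j
    fin_cases i <;> fin_cases j <;> simp [e01, e10, e11, h]
  · right
    ext i j
    fin_cases i <;> fin_cases j <;> simp [e01, e10, e11, h]

/-- For traceless M, adj M = -M, whence MA - adj(A)M = MA + adj(MA) = tr(MA). -/
theorem mul_eq_adjugate_mul_iff_trace_eq_zero
    {A M : Matrix (Fin 2) (Fin 2) R} (hM : M.trace = 0) :
    M * A = A.adjugate * M ↔ (M * A).trace = 0 := by
  rw [Matrix.trace_fin_two] at hM
  have h11 : M 1 1 = -M 0 0 := by linear_combination hM
  have key : M * A - A.adjugate * M = (M * A).trace • 1 := by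
    rw [Matrix.adjugate_fin_two, Matrix.trace_fin_two]
    ext i j
    fin_cases i <;> fin_cases j <;> simp [-Matrix.cons_mul, Matrix.mul_apply, Fin.sum_univ_two, h11] <;>
      ring
  rw [← sub_eq_zero, key]
  constructor
  · intro h
    simpa using congrFun (congrFun h 0) 0
  · intro h
    rw [h, zero_smul]

theorem mul_det_eq_neg_one_iff {η : Rˣ} {a b d : R} :
    (η : R) * (!![a, b; d, -a] : Matrix (Fin 2) (Fin 2) R).det = -1 ↔
      a * a + b * d = ((η⁻¹ : Rˣ) : R) := by
  have h := Units.mul_inv η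
  rw [Matrix.det_fin_two_of]
  constructor
  · intro h'
    linear_combination (-((η⁻¹ : Rˣ) : R)) * h' - (a * a + b * d) * h
  · intro h'
    linear_combination (-(η : R)) * h' - h

theorem trace_mul_normalForm (s : ℤˣ) {a b d π x : R} :
    ((!![a, b; d, -a] : Matrix (Fin 2) (Fin 2) R) * (normalForm s π (π * x)).val).trace =
      ((s : ℤ) : R) * (π * (b - x * d + a * (π * x))) := by
  simp only [normalForm, Matrix.mul_fin_two, Matrix.trace_fin_two_of]
  ring

/-- The first equation determines b modulo the annihilator of π; the second then asks the binary
form a² - πx·ad + x·d² to represent η⁻¹, up to that ambiguity. -/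
theorem exists_iff_of_normalForm {η : Rˣ} (s : ℤˣ) {π x : R} :
    (∃ M : Matrix (Fin 2) (Fin 2) R, M.trace = 0 ∧
      (M * (normalForm s π (π * x)).val).trace = 0 ∧ (η : R) * M.det = -1) ↔
    ∃ a b d : R, π * (b - x * d + a * (π * x)) = 0 ∧ a * a + b * d = ((η⁻¹ : Rˣ) : R) := by
  have hs := intUnits_cast_mul_self (R := R) s
  constructor
  · rintro ⟨M, h1, h2, h3⟩
    have hM : M = !![M 0 0, M 0 1; M 1 0, -M 0 0] := by
      rw [Matrix.trace_fin_two] at h1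
      conv_lhs => rw [Matrix.eta_fin_two M]
      rw [← eq_neg_of_add_eq_zero_right h1]
    rw [hM] at h2 h3
    rw [trace_mul_normalForm] at h2
    refine ⟨_, _, _, ?_, mul_det_eq_neg_one_iff.1 h3⟩
    linear_combination ((s : ℤ) : R) * h2 - (π * (M 0 1 - x * M 1 0 + M 0 0 * (π * x))) * hs
  · rintro ⟨a, b, d, h1, h2⟩
    refine ⟨!![a, b; d, -a], ?_, ?_, mul_det_eq_neg_one_iff.2 h2⟩
    · rw [Matrix.trace_fin_two_of, add_neg_cancel]
    · rw [trace_mul_normalForm, h1, mul_zero]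

end StronglyReal

namespace IsInertExtension

variable {R S : Type*} [CommRing R] [IsLocalRing R] [CommRing S]
  {ι : R →+* S} {c : S →+* S} {ε : Sˣ} {η : Rˣ}

theorem ofNegDet_det (E : IsInertExtension ι c ε η) {A : Matrix (Fin 2) (Fin 2) R}
    (hA : (η : R) * A.det = -1) : (E.ofNegDet A hA).val.val.det = -1 := by
  rw [ofNegDet_val, Matrix.det_smul, det_map, Fintype.card_fin, sq, E.mul_self, ← map_mul, hA,
    map_neg, map_one]

theorem ofSL_eq_of_eq_neg_one (E : IsInertExtension ι c ε η) {A : SpecialLinearGroup (Fin 2) R}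
    (hA : A.val = -1) : (E.ofSL A).val.val = -1 := by
  rw [ofSL_val, hA]
  ext i j
  fin_cases i <;> fin_cases j <;> simp

theorem isStronglyRealElement_ofSL_of_mul_self (E : IsInertExtension ι c ε η)
    (h2 : IsUnit (2 : R)) {A : SpecialLinearGroup (Fin 2) R} (hA : A.val = 1 ∨ A.val = -1) :
    IsStronglyRealElement (E.ofSL A) := by
  have hS : Nontrivial S := E.injective.nontrivial
  obtain ⟨N, hN⟩ : ∃ N : SpecialLinearGroup (Fin 2) R, N.val = -1 :=
    ⟨⟨-1, by simp [Matrix.det_neg]⟩, rfl⟩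
  have hNS := E.ofSL_eq_of_eq_neg_one hN
  refine ⟨E.ofSL N, orderOf_eq_prime (twistedUnitary_ext ?_) fun h => ?_, ?_⟩
  · rw [sq]
    change (E.ofSL N).val.val * (E.ofSL N).val.val = 1
    rw [hNS, neg_one_mul, neg_neg]
  · have h1 : (E.ofSL N).val.val = 1 := congrArg (fun x => x.val.val) h
    rw [hNS] at h1
    have h3 := congrFun (congrFun h1 0) 0
    simp only [Matrix.neg_apply, Matrix.one_apply_eq] at h3
    have h2S := h2.map ι
    rw [map_ofNat] at h2S
    exact one_ne_zero (h2S.mul_right_eq_zero.1 (by linear_combination -h3))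
  · have hAA : A.val * A.val = 1 := by
      rcases hA with h | h
      · rw [h, Matrix.one_mul]
      · rw [h, neg_one_mul, neg_neg]
    have hinv : A⁻¹ = A := inv_eq_of_mul_eq_one_right (Subtype.ext hAA)
    rw [mul_inv_eq_iff_eq_mul, E.ofSL_inv, hinv]
    refine twistedUnitary_ext ?_
    change (E.ofSL N).val.val * (E.ofSL A).val.val = (E.ofSL A).val.val * (E.ofSL N).val.val
    rw [hNS, neg_one_mul, mul_neg_one]

/-- An involution has determinant ±1. With determinant 1 it is the central element -1, so A = A⁻¹;
with determinant -1 it is εM with M traceless. -/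
theorem isStronglyRealElement_ofSL_iff (E : IsInertExtension ι c ε η)
    (h2 : IsUnit (2 : R)) {A : SpecialLinearGroup (Fin 2) R} :
    IsStronglyRealElement (E.ofSL A) ↔ (A.val = 1 ∨ A.val = -1) ∨
      ∃ M : Matrix (Fin 2) (Fin 2) R,
        M.trace = 0 ∧ (M * A.val).trace = 0 ∧ (η : R) * M.det = -1 := by
  have hS : Nontrivial S := E.injective.nontrivial
  have h2S : IsUnit (2 : S) := by
    have := h2.map ι
    rwa [map_ofNat] at this
  have hAinv : (A⁻¹).val = A.val.adjugate :=
    Matrix.SpecialLinearGroup.coe_inv A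
  constructor
  · rintro ⟨t, ht, hconj⟩
    have ht2 : t.val.val * t.val.val = 1 := by
      have := pow_orderOf_eq_one t
      rw [ht, sq] at this
      exact congrArg (fun x => x.val.val) this
    have ht1 : t ≠ 1 := fun h => by
      rw [h, orderOf_one] at ht
      omega
    have hd : t.val.val.det * t.val.val.det = 1 := by
      rw [← Matrix.det_mul, ht2, Matrix.det_one]
    rw [mul_inv_eq_iff_eq_mul, E.ofSL_inv] at hconj
    rcases E.det_eq_one_or_neg_one h2 t.2 hd with h1 | h1
    · left
      obtain ⟨B, hB⟩ := E.exists_eq_map_of_det_eq_one h2 t.2 h1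
      obtain rfl : t = E.ofSL B := twistedUnitary_ext hB
      have hBB : B.val * B.val = 1 := E.map_matrix_injective (by
        rw [Matrix.map_mul, ← hB, ht2, Matrix.map_one _ (map_zero _) (map_one _)])
      have hB1 : B.val = -1 := by
        refine (eq_one_or_neg_one_of_mul_self_eq_one h2 B.2 hBB).resolve_left fun h => ht1 ?_
        refine twistedUnitary_ext ?_
        rw [ofSL_val, h, Matrix.map_one _ (map_zero _) (map_one _)]
        rfl
      have h : (E.ofSL B).val.val * A.val.map ι = (A⁻¹).val.map ι * (E.ofSL B).val.val :=
        congrArg (fun x => x.val.val) hconj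
      rw [E.ofSL_eq_of_eq_neg_one hB1, neg_one_mul, mul_neg_one, neg_inj] at h
      have hA := E.map_matrix_injective h
      have hA' : A = A⁻¹ := Subtype.ext hA
      exact eq_one_or_neg_one_of_mul_self_eq_one h2 A.2
        (congrArg Subtype.val ((congrArg (A * ·) hA').trans (mul_inv_cancel A)))
    · right
      obtain ⟨M, hM, hdet⟩ := E.exists_eq_smul_of_det_eq_neg_one h2 t.2 h1
      have hsq : (η : R) • (M * M) = 1 := E.map_matrix_injective (by
        rw [Matrix.map_one _ (map_zero _) (map_one _), ← ht2, hM, Matrix.smul_mul, Matrix.mul_smul,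
          smul_smul, E.mul_self, ← Matrix.map_mul]
        ext i j
        exact map_mul ι _ _)
      -- The relations ηM² = 1 and η·det M = -1 identify the adjugate, and hence give trace zero.
      have hadj : M.adjugate = -M := by
        calc M.adjugate = M.adjugate * ((η : R) • (M * M)) := by rw [hsq, Matrix.mul_one]
          _ = ((η : R) * M.det) • M := by
            rw [Matrix.mul_smul, ← Matrix.mul_assoc, Matrix.adjugate_mul, Matrix.smul_mul,
              Matrix.one_mul, smul_smul]
          _ = -M := by rw [hdet, neg_one_smul]
      have htr : M.trace = 0 := by
        have := congrFun (congrFun hadj 0) 0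
        rw [Matrix.adjugate_fin_two] at this
        rw [Matrix.trace_fin_two]
        simp only [of_apply, cons_val', cons_val_zero, Matrix.neg_apply] at this
        linear_combination this
      refine ⟨M, htr, (mul_eq_adjugate_mul_iff_trace_eq_zero htr).1 ?_, hdet⟩
      have h : t.val.val * A.val.map ι = (A⁻¹).val.map ι * t.val.val :=
        congrArg (fun x => x.val.val) hconj
      rw [hM, Matrix.smul_mul, Matrix.mul_smul, ← Matrix.map_mul, ← Matrix.map_mul, hAinv] at h
      exact E.map_matrix_injective (ε.isUnit.smul_left_cancel.1 h)
  · rintro (h | ⟨M, htr, hMA, hdet⟩)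
    · exact E.isStronglyRealElement_ofSL_of_mul_self h2 h
    · refine ⟨E.ofNegDet M hdet, orderOf_eq_prime ?_ fun h => ?_, ?_⟩
      · rw [sq]
        exact E.ofNegDet_mul_self hdet htr
      · have := E.ofNegDet_det hdet
        rw [h] at this
        change (1 : Matrix (Fin 2) (Fin 2) S).det = -1 at this
        rw [Matrix.det_one] at this
        exact one_ne_zero (h2S.mul_right_eq_zero.1 (by linear_combination this))
      · rw [mul_inv_eq_iff_eq_mul, E.ofSL_inv]
        refine twistedUnitary_ext ?_
        change ((ε : S) • M.map ι) * A.val.map ι = (A⁻¹).val.map ι * ((ε : S) • M.map ι)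
        rw [Matrix.smul_mul, Matrix.mul_smul, ← Matrix.map_mul, ← Matrix.map_mul, hAinv,
          (mul_eq_adjugate_mul_iff_trace_eq_zero htr).2 hMA]

/-! ### Strongly real normal forms -/

variable {ϖ : R} {ℓ q : ℕ}

/-- A condition for a normal form to be inverted by an involution. -/
theorem exists_of_isUnit_discriminant [Finite R] (h2 : IsUnit (2 : R)) {π x : R}
    (h : IsUnit ((π * x) * (π * x) - 4 * x)) :
    ∃ a b d : R, π * (b - x * d + a * (π * x)) = 0 ∧ a * a + b * d = ((η⁻¹ : Rˣ) : R) := by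
  obtain ⟨z, hz⟩ := h2.exists_right_inv
  have hz' : IsUnit z := IsUnit.of_mul_eq_one 2 (by rwa [mul_comm])
  -- Completing the square with z = 1/2: the form becomes a² - (D/4)d², where D is the discriminant.
  -- The witness undoes the shift of a and solves the linear equation for b.
  obtain ⟨a, d, had⟩ := exists_sq_sub_mul_sq_eq h2 ((h.mul hz').mul hz') (η⁻¹).isUnit
  refine ⟨a + z * (π * x) * d, x * d - (a + z * (π * x) * d) * (π * x), d, by ring, ?_⟩
  linear_combination had + (π * x) * a * d * hz + (d * d) * ((π*x)*(π*x) * z - x - 2 * x * z) * hz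

/-- If the discriminant lay in m, the form would be residually the square (a - yd/2)², which cannot
equal the non-square η⁻¹. -/
theorem discriminant_notMem (E : IsInertExtension ι c ε η) (h2 : IsUnit (2 : R)) {x y a d : R}
    (h : a * a - y * a * d + x * (d * d) - ((η⁻¹ : Rˣ) : R) ∈ maximalIdeal R) :
    y * y - 4 * x ∉ maximalIdeal R := by
  intro hm
  obtain ⟨z, hz⟩ := h2.exists_right_inv
  refine E.sq_sub_notMem (a - z * y * d) ?_
  have := add_mem h (Ideal.mul_mem_left _ (z * z * (d * d)) hm)
  convert this using 1
  linear_combination (-(y * a * d) + x * (d * d) * (1 + 2 * z)) * hz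

/-- For regular forms the discriminant is y(y - 4). For the others it is congruent to -4x, so it is
a unit exactly when y = πx is not divisible by ϖπ; at the last exponent the matrix is ±1. -/
theorem isStronglyRealElement_formOf_iff (H : IsOddLevelRing R ϖ ℓ q)
    (E : IsInertExtension ι c ε η) (a : FormIndex ϖ ℓ) :
    IsStronglyRealElement (E.ofSL (formOf a)) ↔ IsStrongIndex a := by
  have := H.finite
  have h2 := H.isUnit_two
  rw [E.isStronglyRealElement_ofSL_iff h2]
  rcases a with y | ⟨i, s, y, hy⟩
  · change ((normalForm 1 1 y).val = 1 ∨ (normalForm 1 1 y).val = -1) ∨ _ ↔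
      y ∉ maximalIdeal R ∧ y - 4 ∉ maximalIdeal R
    have h10 : (normalForm 1 1 y).val 1 0 = 1 := by simp [normalForm]
    have hne : ¬ ((normalForm 1 1 y).val = 1 ∨ (normalForm 1 1 y).val = -1) := by
      rintro (h | h) <;> rw [h] at h10 <;> simp at h10
    rw [or_iff_right hne]
    have hy := exists_iff_of_normalForm (R := R) (η := η) 1 (π := 1) (x := y)
    rw [one_mul] at hy
    change (∃ M : Matrix (Fin 2) (Fin 2) R, M.trace = 0 ∧
      (M * (normalForm 1 1 y).val).trace = 0 ∧ (η : R) * M.det = -1) ↔ _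
    rw [hy]
    constructor
    · rintro ⟨a, b, d, h1, h3⟩
      have hD := E.discriminant_notMem h2 (x := y) (y := y) (a := a) (d := d) (by
        have : a * a - y * a * d + y * (d * d) - ((η⁻¹ : Rˣ) : R) = 0 := by
          linear_combination h3 - d * h1
        rw [this]
        exact zero_mem _)
      constructor <;> intro hm <;> refine hD ?_
      · have := Ideal.mul_mem_left _ (y - 4) hm
        convert this using 1
        ring
      · have := Ideal.mul_mem_left _ y hm
        convert this using 1
        ring
    · rintro ⟨h1, h3⟩
      have := exists_of_isUnit_discriminant (η := η) h2 (π := 1) (x := y) (by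
        have : 1 * y * (1 * y) - 4 * y = y * (y - 4) := by ring
        rw [this]
        exact (not_not.1 fun h => h1 ((mem_maximalIdeal _).2 h)).mul
          (not_not.1 fun h => h3 ((mem_maximalIdeal _).2 h)))
      simpa only [one_mul] using this
  · obtain ⟨x, rfl⟩ := Ideal.mem_span_singleton'.1 hy
    change ((normalForm s (ϖ ^ (i.val + 1)) (x * ϖ ^ (i.val + 1))).val = 1 ∨
      (normalForm s (ϖ ^ (i.val + 1)) (x * ϖ ^ (i.val + 1))).val = -1) ∨
      (∃ M : Matrix (Fin 2) (Fin 2) R, M.trace = 0 ∧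
        (M * (normalForm s (ϖ ^ (i.val + 1)) (x * ϖ ^ (i.val + 1))).val).trace = 0 ∧
          (η : R) * M.det = -1) ↔
      i.val + 1 = ℓ ∨ x * ϖ ^ (i.val + 1) ∉ Ideal.span {ϖ ^ (i.val + 2)}
    by_cases hi : i.val + 1 = ℓ
    · refine iff_of_true (Or.inl ?_) (Or.inl hi)
      rw [hi, H.pow_eq_zero]
      rcases Int.units_eq_one_or s with rfl | rfl
      · left
        ext i j
        fin_cases i <;> fin_cases j <;> simp [normalForm]
      · right
        ext i j
        fin_cases i <;> fin_cases j <;> simp [normalForm]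
    · have hlt : i.val + 1 < ℓ := by omega
      rw [or_iff_right hi]
      have hne : ¬ ((normalForm s (ϖ ^ (i.val + 1)) (x * ϖ ^ (i.val + 1))).val = 1 ∨
          (normalForm s (ϖ ^ (i.val + 1)) (x * ϖ ^ (i.val + 1))).val = -1) := by
        have h10 : (normalForm s (ϖ ^ (i.val + 1)) (x * ϖ ^ (i.val + 1))).val 1 0 =
          ((s : ℤ) : R) * ϖ ^ (i.val + 1) := by simp [normalForm]
        have h0 : ((s : ℤ) : R) * ϖ ^ (i.val + 1) ≠ 0 := fun h => H.pow_ne_zero hlt (by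
          linear_combination ((s : ℤ) : R) * h -
            ϖ ^ (i.val + 1) * intUnits_cast_mul_self (R := R) s)
        rintro (h | h) <;> rw [h] at h10 <;> exact h0 (by simpa using h10.symm)
      have hx : x * ϖ ^ (i.val + 1) ∉ Ideal.span {ϖ ^ (i.val + 2)} ↔ x ∉ maximalIdeal R := by
        rw [not_iff_not, Ideal.mem_span_singleton']
        constructor
        · rintro ⟨z, hz⟩
          exact H.mem_maximalIdeal_of_pow_mul_mem hlt (y := z) (by linear_combination -hz)
        · intro hm
          obtain ⟨z, rfl⟩ := H.mem_maximalIdeal_iff.1 hm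
          exact ⟨z, by ring⟩
      have hm : ϖ ^ (i.val + 1) * x ∈ maximalIdeal R :=
        Ideal.mul_mem_right _ _ (Ideal.pow_mem_of_mem _ H.self_mem _ (Nat.succ_pos _))
      have hdisc : ∀ y ∈ maximalIdeal R, y * y - 4 * x ∈ maximalIdeal R ↔ x ∈ maximalIdeal R := by
        intro y hy
        rw [Submodule.sub_mem_iff_right _ (Ideal.mul_mem_left _ y hy)]
        exact Ideal.unit_mul_mem_iff_mem _
          (not_not.1 fun h => H.four_notMem ((mem_maximalIdeal _).2 h))
      rw [or_iff_right hne, hx, mul_comm x, exists_iff_of_normalForm]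
      constructor
      · rintro ⟨a, b, d, h1, h3⟩
        -- Cancelling ϖ ^ (i + 1) determines b only modulo m, which suffices for a residual
        -- criterion.
        have hb := H.mem_maximalIdeal_of_pow_mul_mem hlt (y := 0) (h1.trans (mul_zero _).symm)
        have := E.discriminant_notMem h2 (x := x) (y := ϖ ^ (i.val + 1) * x) (a := a) (d := d) (by
          have := neg_mem (Ideal.mul_mem_left _ d hb)
          convert this using 1
          linear_combination h3)
        rwa [hdisc _ hm] at this
      · intro h
        refine exists_of_isUnit_discriminant h2 (not_not.1 fun hu => h ?_)
        exact (hdisc _ hm).1 ((mem_maximalIdeal _).2 hu)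

end IsInertExtension

/-! ### Transfer of classes along an isomorphism -/

section Transfer

variable {G K : Type*} [Group G] [Group K]

theorem ConjClasses.map_injective_of_mulEquiv (e : G ≃* K) :
    Function.Injective (ConjClasses.map e.toMonoidHom) := by
  refine Function.LeftInverse.injective (g := ConjClasses.map e.symm.toMonoidHom) fun c => ?_
  obtain ⟨g, rfl⟩ := ConjClasses.exists_rep c
  exact congrArg ConjClasses.mk (e.symm_apply_apply g)

theorem classesContaining_mulEquiv (e : G ≃* K) {P : G → Prop} {Q : K → Prop}
    (h : ∀ g, Q (e g) ↔ P g) :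
    classesContaining Q = ConjClasses.map e.toMonoidHom '' classesContaining P := by
  ext c
  constructor
  · rintro ⟨k, rfl, hk⟩
    obtain ⟨g, rfl⟩ := e.surjective k
    exact ⟨ConjClasses.mk g, ⟨g, rfl, (h g).1 hk⟩, rfl⟩
  · rintro ⟨-, ⟨g, rfl, hg⟩, rfl⟩
    exact ⟨e g, rfl, (h g).2 hg⟩

theorem isRealElement_mulEquiv (e : G ≃* K) (g : G) : IsRealElement (e g) ↔ IsRealElement g := by
  constructor
  · rintro ⟨t, ht⟩
    obtain ⟨t, rfl⟩ := e.surjective t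
    exact ⟨t, e.injective (by simpa using ht)⟩
  · rintro ⟨t, ht⟩
    exact ⟨e t, by simpa using congrArg e ht⟩

theorem isStronglyRealElement_mulEquiv (e : G ≃* K) (g : G) :
    IsStronglyRealElement (e g) ↔ IsStronglyRealElement g := by
  constructor
  · rintro ⟨t, ht2, ht⟩
    obtain ⟨t, rfl⟩ := e.surjective t
    exact ⟨t, by rwa [MulEquiv.orderOf_eq] at ht2, e.injective (by simpa using ht)⟩
  · rintro ⟨t, ht2, ht⟩
    exact ⟨e t, by rwa [MulEquiv.orderOf_eq], by simpa using congrArg e ht⟩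

end Transfer

/-! ### The unitary group -/

namespace IsInertExtension

variable {R S : Type*} [CommRing R] [IsLocalRing R] [CommRing S]
  {ι : R →+* S} {c : S →+* S} {ε : Sˣ} {η : Rˣ}

theorem isConj_val {g h : twistedUnitary c ε} (hgh : IsConj g h) :
    IsConj g.val.val h.val.val := by
  obtain ⟨k, rfl⟩ := isConj_iff.1 hgh
  exact isConj_iff_isConj_val.1 (isConj_iff.2 ⟨k.val, rfl⟩)

theorem isResiduallyScalar_map_iff [IsLocalRing S] (E : IsInertExtension ι c ε η)
    {A : Matrix (Fin 2) (Fin 2) R} : IsResiduallyScalar (A.map ι) ↔ IsResiduallyScalar A := by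
  have h : ∀ a : R, ι a ∈ maximalIdeal S ↔ a ∈ maximalIdeal R := fun a => by
    rw [mem_maximalIdeal, mem_maximalIdeal, mem_nonunits_iff, mem_nonunits_iff, not_iff_not]
    exact ⟨E.isUnit_of_map, fun h => h.map ι⟩
  simp only [IsResiduallyScalar, Matrix.map_apply, ← map_sub, h]

theorem isResiduallyScalar_twistedUnitaryEquiv [IsLocalRing S] (g : twistedUnitary c ε) :
    IsResiduallyScalar (twistedUnitaryEquiv c ε g).val.val ↔ IsResiduallyScalar g.val.val := by
  have h : IsConj g.val.val (twistedUnitaryEquiv c ε g).val.val :=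
    isConj_iff_isConj_val.1 (isConj_iff.2 ⟨diagonalUnit ε, rfl⟩)
  exact ⟨isResiduallyScalar_of_isConj h.symm, isResiduallyScalar_of_isConj h⟩

variable {ϖ : R} {ℓ q : ℕ}

/-- These elements are εA with A traceless of determinant -η⁻¹, hence regular, so all such A are
similar over R to the companion matrix of X² - η⁻¹. -/
theorem exists_negDet_representative [Finite R] (E : IsInertExtension ι c ε η)
    (h2 : IsUnit (2 : R)) : ∃ w : twistedUnitary c ε, w * w = 1 ∧ w.val.val.det = -1 ∧
      w.val.val.trace = 0 ∧ ∀ g : twistedUnitary c ε, g.val.val.det = -1 → g.val.val.trace = 0 →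
        IsConj g w := by
  let W : Matrix (Fin 2) (Fin 2) R := !![0, ((η⁻¹ : Rˣ) : R); 1, 0]
  have hW : (η : R) * W.det = -1 := by
    rw [Matrix.det_fin_two_of, zero_mul, zero_sub, mul_one, mul_neg, Units.mul_inv]
  have htW : W.trace = 0 := by rw [Matrix.trace_fin_two_of, add_zero]
  have hreg : ∀ A : Matrix (Fin 2) (Fin 2) R, A.trace = 0 → (η : R) * A.det = -1 →
      ¬ IsResiduallyScalar A := fun A ht hd =>
    not_isResiduallyScalar_of_trace_eq_zero h2 ht (isUnit_of_mul_isUnit_right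
      (hd ▸ isUnit_one.neg : IsUnit ((η : R) * A.det)))
  have htr : ∀ A : Matrix (Fin 2) (Fin 2) R, ((ε : S) • A.map ι).trace = ε * ι A.trace := by
    intro A
    simp [Matrix.trace_fin_two, mul_add]
  refine ⟨E.ofNegDet W hW, E.ofNegDet_mul_self hW htW, E.ofNegDet_det hW, ?_, fun g hd ht => ?_⟩
  · rw [ofNegDet_val, htr, htW, map_zero, mul_zero]
  · obtain ⟨A, hA, hdA⟩ := E.exists_eq_smul_of_det_eq_neg_one h2 g.2 hd
    rw [hA, htr] at ht
    have htA : A.trace = 0 := E.injective (by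
      rw [map_zero]
      exact ε.isUnit.mul_right_eq_zero.1 ht)
    have hdet : A.det = W.det := η.isUnit.mul_left_cancel (hdA.trans hW.symm)
    obtain ⟨k, hk, hkA⟩ := E.exists_mem_twistedUnitary_of_isConj h2
      (isConj_of_trace_det (hreg A htA hdA) (hreg W htW hW) (htA.trans htW.symm) hdet)
    refine isConj_iff.2 ⟨⟨k, hk⟩, ?_⟩
    rw [mul_inv_eq_iff_eq_mul]
    refine twistedUnitary_ext ?_
    change k.val * g.val.val = (E.ofNegDet W hW).val.val * k.val
    rw [hA, ofNegDet_val, Matrix.mul_smul, Matrix.smul_mul, hkA]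

theorem real_dichotomy (E : IsInertExtension ι c ε η)
    (h2 : IsUnit (2 : R)) {g : twistedUnitary c ε} (hg : IsRealElement g) :
    (∃ A, g = E.ofSL A) ∨ (g.val.val.det = -1 ∧ g.val.val.trace = 0) := by
  have hconj : IsConj g.val.val (g.val⁻¹).val := isConj_val (isConj_iff.2 hg)
  obtain ⟨h1, h3⟩ := det_trace_of_isConj_inv hconj
  rcases E.det_eq_one_or_neg_one h2 g.2 h1 with h | h
  · left
    obtain ⟨A, hA⟩ := E.exists_eq_map_of_det_eq_one h2 g.2 h
    exact ⟨A, twistedUnitary_ext hA⟩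
  · right
    rw [h, neg_one_mul] at h3
    have h2S := h2.map ι
    rw [map_ofNat] at h2S
    exact ⟨h, trace_eq_zero_of_eq_neg h2S h3⟩

/-- The counting takes place in the twisted group and is carried over by the isomorphism; the extra
class is strongly real because `w`, being an involution, inverts itself. -/
theorem ncard_classes [IsLocalRing S] (H : IsOddLevelRing R ϖ ℓ q)
    (E : IsInertExtension ι c ε η) (reg : unitaryGroupTwo c → Prop)
    (hreg : ∀ g, reg g ↔ ¬ IsResiduallyScalar g.val.val) :
    (realClasses (unitaryGroupTwo c)).ncard = 1 + q ^ ℓ + 2 * ∑ i ∈ Finset.range ℓ, q ^ i ∧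
      (realClasses (unitaryGroupTwo c) ∩ classesContaining reg).ncard = q ^ ℓ + 1 ∧
      (realClasses (unitaryGroupTwo c) \ classesContaining reg).ncard =
        2 * ∑ i ∈ Finset.range ℓ, q ^ i ∧
      (stronglyRealClasses (unitaryGroupTwo c)).ncard = q ^ ℓ + 1 := by
  have := H.finite
  have h2 := H.isUnit_two
  have h2S := h2.map ι
  rw [map_ofNat] at h2S
  obtain ⟨w, hww, hwd, hwt, hw⟩ := E.exists_negDet_representative h2
  have hw1 : w ≠ 1 := by
    rintro rfl
    refine one_ne_neg_one h2S (Eq.trans ?_ hwd)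
    exact (Matrix.det_one (n := Fin 2)).symm
  have hwstrong : IsStronglyRealElement w :=
    ⟨w, orderOf_eq_prime (by rw [sq, hww]) hw1, by
      rw [mul_inv_cancel_right]
      exact eq_inv_of_mul_eq_one_left hww⟩
  have hreal : ∀ g : twistedUnitary c ε, IsRealElement g → (∃ A, g = E.ofSL A) ∨ IsConj g w :=
    fun g hg => (E.real_dichotomy h2 hg).imp_right fun h => hw g h.1 h.2
  have hfw : ∀ A, ¬ IsConj (E.ofSL A) w := fun A h => by
    have := Matrix.det_eq_of_isConj (isConj_val h)
    rw [ofSL_val, det_map, A.2, map_one, hwd] at this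
    exact one_ne_neg_one h2S this
  have hfreal : ∀ A, IsRealElement (E.ofSL A) := fun A => by
    refine isConj_iff.1 ?_
    rw [E.ofSL_inv, E.isConj_ofSL_iff h2]
    have h : (A⁻¹).val = A.val.adjugate := Matrix.SpecialLinearGroup.coe_inv A
    rw [h]
    exact isConj_adjugate H A
  have hcount := ncard_real_classes H E.ofSL w (fun g => ¬ IsResiduallyScalar g.val.val)
    (E.isConj_ofSL_iff h2) hreal hfreal (isRealElement_of_isStronglyRealElement hwstrong) hfw
    (fun g h hgh hg hh => hg (isResiduallyScalar_of_isConj (isConj_val hgh.symm) hh))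
    (fun A => by rw [ofSL_val, E.isResiduallyScalar_map_iff])
    (not_isResiduallyScalar_of_trace_eq_zero h2S hwt (hwd ▸ isUnit_one.neg))
  have hstrong := ncard_classesContaining H E.ofSL w (E.isConj_ofSL_iff h2)
    (P := fun g => IsStronglyRealElement g) (fun _ _ => isStronglyRealElement_of_isConj)
    (E.isStronglyRealElement_formOf_iff H) hwstrong
    (fun g hg => hreal g (isRealElement_of_isStronglyRealElement hg)) hfw
  rw [ncard_isStrongIndex H] at hstrong
  have hinj := ConjClasses.map_injective_of_mulEquiv (twistedUnitaryEquiv c ε)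
  have e1 : realClasses (unitaryGroupTwo c) = _ '' realClasses (twistedUnitary c ε) :=
    classesContaining_mulEquiv (twistedUnitaryEquiv c ε) (isRealElement_mulEquiv _)
  have e2 : stronglyRealClasses (unitaryGroupTwo c) = _ ''
      classesContaining fun g : twistedUnitary c ε => IsStronglyRealElement g :=
    classesContaining_mulEquiv (twistedUnitaryEquiv c ε) (isStronglyRealElement_mulEquiv _)
  have e3 : classesContaining reg = _ '' _ :=
    classesContaining_mulEquiv (twistedUnitaryEquiv c ε)
      (P := fun g => ¬ IsResiduallyScalar g.val.val)
      (fun g => by rw [hreg, isResiduallyScalar_twistedUnitaryEquiv])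
  rw [e1, e2, e3, ← Set.image_inter hinj, ← Set.image_sdiff hinj,
    Set.ncard_image_of_injective _ hinj, Set.ncard_image_of_injective _ hinj,
    Set.ncard_image_of_injective _ hinj, Set.ncard_image_of_injective _ hinj]
  exact ⟨hcount.1, hcount.2.1, hcount.2.2, hstrong⟩

end IsInertExtension

/-! ### The quotients of a discrete valuation ring -/

section Level

variable {o : Type*} [CommRing o] [IsLocalRing o] {ℓ : ℕ}

theorem nontrivial_levelRing (hℓ : 1 ≤ ℓ) : Nontrivial (LevelRing o ℓ) :=
  Ideal.Quotient.nontrivial_iff.2 fun h =>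
    (Ideal.IsPrime.ne_top inferInstance : maximalIdeal o ≠ ⊤)
      (top_le_iff.1 (h ▸ Ideal.pow_le_self (Nat.one_le_iff_ne_zero.1 hℓ)))

theorem isLocalRing_levelRing (hℓ : 1 ≤ ℓ) : IsLocalRing (LevelRing o ℓ) :=
  have := nontrivial_levelRing (o := o) hℓ
  IsLocalRing.of_surjective' (Ideal.Quotient.mk (maximalIdeal o ^ ℓ)) Ideal.Quotient.mk_surjective

theorem mk_mem_maximalIdeal_iff [IsLocalRing (LevelRing o ℓ)] {a : o} :
    (Ideal.Quotient.mk (maximalIdeal o ^ ℓ) a) ∈ maximalIdeal (LevelRing o ℓ) ↔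
      a ∈ maximalIdeal o := by
  have := IsLocalHom.of_surjective (Ideal.Quotient.mk (maximalIdeal o ^ ℓ))
    Ideal.Quotient.mk_surjective
  rw [mem_maximalIdeal, mem_maximalIdeal, mem_nonunits_iff, mem_nonunits_iff,
    isUnit_map_iff (Ideal.Quotient.mk (maximalIdeal o ^ ℓ))]

theorem isUnit_two_of_ringChar_ne_two (h : ringChar (ResidueField o) ≠ 2) : IsUnit (2 : o) := by
  by_contra h2
  have h0 : residue o 2 = 0 := (residue_eq_zero_iff _).2 ((mem_maximalIdeal _).2 h2)
  rw [map_ofNat] at h0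
  have hdvd : ringChar (ResidueField o) ∣ 2 := ringChar.dvd (by exact_mod_cast h0)
  rcases (Nat.dvd_prime Nat.prime_two).1 hdvd with h1 | h1
  · have := ringChar.Nat.cast_ringChar (R := ResidueField o)
    rw [h1, Nat.cast_one] at this
    exact one_ne_zero this
  · exact h h1

end Level

section DVR

variable {o : Type*} [CommRing o] [IsDomain o] [IsDiscreteValuationRing o]

theorem natCard_levelRing (ℓ : ℕ) :
    Nat.card (LevelRing o ℓ) = Nat.card (ResidueField o) ^ ℓ := by
  have := cardQuot_pow_of_prime (P := maximalIdeal o) (IsDiscreteValuationRing.not_a_field o)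
    (i := ℓ)
  rw [Submodule.cardQuot_apply, Submodule.cardQuot_apply] at this
  exact this

theorem isOddLevelRing_levelRing [Finite (ResidueField o)] (hodd : ringChar (ResidueField o) ≠ 2)
    {p : o} (hp : maximalIdeal o = Ideal.span {p}) {ℓ : ℕ} (hℓ : 1 ≤ ℓ)
    [IsLocalRing (LevelRing o ℓ)] :
    IsOddLevelRing (LevelRing o ℓ) (Ideal.Quotient.mk _ p) ℓ (Nat.card (ResidueField o)) where
  finite := Nat.finite_of_card_ne_zero (by
    rw [natCard_levelRing]
    exact pow_ne_zero _ Nat.card_pos.ne')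
  isUnit_two := by
    have := (isUnit_two_of_ringChar_ne_two hodd).map (Ideal.Quotient.mk (maximalIdeal o ^ ℓ))
    rwa [map_ofNat] at this
  maximalIdeal_eq := by
    ext x
    obtain ⟨a, rfl⟩ := Ideal.Quotient.mk_surjective x
    rw [mk_mem_maximalIdeal_iff]
    constructor
    · intro h
      obtain ⟨b, rfl⟩ := Ideal.mem_span_singleton'.1 (hp.le h)
      exact Ideal.mem_span_singleton'.2 ⟨Ideal.Quotient.mk _ b, (map_mul _ _ _).symm⟩
    · intro h
      rw [← mk_mem_maximalIdeal_iff (ℓ := ℓ)]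
      refine (Ideal.span_singleton_le_iff_mem _).2 ?_ h
      rw [mk_mem_maximalIdeal_iff]
      exact hp.ge (Ideal.mem_span_singleton_self p)
  card_span := by
    intro i hi
    have hq : 0 < Nat.card (ResidueField o) := Nat.card_pos
    have hspan : Ideal.span {(Ideal.Quotient.mk (maximalIdeal o ^ ℓ) p) ^ i} =
        (maximalIdeal o ^ i).map (Ideal.Quotient.mk (maximalIdeal o ^ ℓ)) := by
      have hpow : maximalIdeal o ^ i = Ideal.span {p ^ i} := by
        rw [hp, Ideal.span_singleton_pow]
      rw [← map_pow, hpow, Ideal.map_span, Set.image_singleton]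
    -- The ideal (ϖ ^ i) has index |o/℘^i| = q^i in a ring with q^ℓ elements.
    have h := Submodule.card_eq_card_quotient_mul_card
      ((maximalIdeal o ^ i).map (Ideal.Quotient.mk (maximalIdeal o ^ ℓ)))
    rw [Nat.card_congr (DoubleQuot.quotQuotEquivQuotOfLE (Ideal.pow_le_pow_right hi)).toEquiv,
      natCard_levelRing, natCard_levelRing, ← hspan] at h
    refine Nat.eq_of_mul_eq_mul_right (pow_pos hq i) ?_
    rw [← h, ← pow_add, Nat.sub_add_cancel hi]
  one_lt := Finite.one_lt_card
  one_le := hℓ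

end DVR

/-! ### Unramified quadratic extensions -/

section Unramified

variable {o O : Type*} [CommRing o] [CommRing O] [Algebra o O]

/-- Exchange: since the coefficient of f in 1 is a unit, 1 can replace f in the basis. -/
theorem exists_one_basis_of_isUnit {f g : O} {u v : o} (hu : IsUnit u) (h1 : 1 = u • f + v • g)
    (hspan : ∀ x, ∃ a b : o, x = a • f + b • g)
    (hind : ∀ a b : o, a • f + b • g = 0 → a = 0 ∧ b = 0) :
    (∀ x, ∃ a b : o, x = algebraMap o O a + algebraMap o O b * g) ∧
      ∀ a b : o, algebraMap o O a + algebraMap o O b * g = 0 → a = 0 ∧ b = 0 := by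
  obtain ⟨w, hw⟩ := hu.exists_left_inv
  simp only [Algebra.smul_def] at h1 hspan hind
  have hw' := congrArg (algebraMap o O) hw
  rw [map_mul, map_one] at hw'
  constructor
  · intro x
    obtain ⟨a, b, rfl⟩ := hspan x
    refine ⟨a * w, b - a * w * v, ?_⟩
    simp only [map_mul, map_sub]
    linear_combination algebraMap o O a * algebraMap o O w * (-1) * h1 -
      algebraMap o O a * f * hw'
  · intro a b hab
    obtain ⟨ha, hb⟩ := hind (a * u) (a * v + b) (by
      simp only [map_mul, map_add]
      linear_combination hab - algebraMap o O a * h1)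
    have ha0 : a = 0 := hu.mul_left_eq_zero.1 ha
    rw [ha0, zero_mul, zero_add] at hb
    exact ⟨ha0, hb⟩

variable [IsDomain o] [IsDiscreteValuationRing o] [IsDomain O] [IsDiscreteValuationRing O]

/-- A nonzero kernel element is a unit times a power of p, so p would map to 0 and the maximal ideal
of O would vanish. -/
theorem IsUnramifiedQuadratic.algebraMap_injective (hO : IsUnramifiedQuadratic o O) :
    Function.Injective (algebraMap o O) := by
  obtain ⟨p, hp⟩ := IsDiscreteValuationRing.exists_irreducible o
  rw [injective_iff_map_eq_zero]
  intro a ha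
  by_contra h0
  obtain ⟨n, u, rfl⟩ := IsDiscreteValuationRing.eq_unit_mul_pow_irreducible h0 hp
  rw [map_mul, map_pow, (u.isUnit.map (algebraMap o O)).mul_right_eq_zero] at ha
  have hp0 := eq_zero_of_pow_eq_zero ha
  refine IsDiscreteValuationRing.not_a_field O ?_
  rw [← hO.map_maximalIdeal, hp.maximalIdeal_eq, Ideal.map_span, Set.image_singleton, hp0,
    Ideal.span_singleton_zero]

theorem IsUnramifiedQuadratic.algebraMap_mem (hO : IsUnramifiedQuadratic o O) {a : o}
    (h : a ∈ maximalIdeal o) : algebraMap o O a ∈ maximalIdeal O := by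
  rw [← hO.map_maximalIdeal]
  exact Ideal.mem_map_of_mem _ h

/-- The coordinates of 1 in a basis cannot both lie in ℘, as 1 would then lie in 𝔓. -/
theorem IsUnramifiedQuadratic.exists_one_basis (hO : IsUnramifiedQuadratic o O) :
    ∃ e : O, (∀ x, ∃ a b : o, x = algebraMap o O a + algebraMap o O b * e) ∧
      ∀ a b : o, algebraMap o O a + algebraMap o O b * e = 0 → a = 0 ∧ b = 0 := by
  have := hO.finite
  have : FaithfulSMul o O :=
    (faithfulSMul_iff_algebraMap_injective o O).2 hO.algebraMap_injective
  let b := Module.finBasisOfFinrankEq o O hO.finrank_eq_two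
  have hspan : ∀ x, ∃ a c : o, x = a • b 0 + c • b 1 := fun x =>
    ⟨b.repr x 0, b.repr x 1, by
      conv_lhs => rw [← b.sum_repr x]
      exact Fin.sum_univ_two _⟩
  have hind : ∀ a c : o, a • b 0 + c • b 1 = 0 → a = 0 ∧ c = 0 := fun a c h => by
    have := Fintype.linearIndependent_iff.1 b.linearIndependent ![a, c] (by
      rw [Fin.sum_univ_two]
      exact h)
    exact ⟨this 0, this 1⟩
  obtain ⟨u, v, huv⟩ := hspan 1
  by_cases hu : IsUnit u
  · exact ⟨b 1, exists_one_basis_of_isUnit hu huv hspan hind⟩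
  · by_cases hv : IsUnit v
    · refine ⟨b 0, exists_one_basis_of_isUnit hv (huv.trans (add_comm _ _)) (fun x => ?_)
        fun a c h => (hind c a ((add_comm _ _).trans h)).symm⟩
      obtain ⟨a, c, h⟩ := hspan x
      exact ⟨c, a, h.trans (add_comm _ _)⟩
    · refine ((mem_maximalIdeal (1 : O)).1 ?_ isUnit_one).elim
      rw [huv, Algebra.smul_def, Algebra.smul_def]
      exact add_mem
        (Ideal.mul_mem_right _ _ (hO.algebraMap_mem ((mem_maximalIdeal _).2 hu)))
        (Ideal.mul_mem_right _ _ (hO.algebraMap_mem ((mem_maximalIdeal _).2 hv)))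

/-- An unramified quadratic extension of odd residue characteristic is generated by the square
root of a non-square unit, on which the automorphism acts by `-1`. -/
theorem IsUnramifiedQuadratic.exists_root (hO : IsUnramifiedQuadratic o O) (h2 : IsUnit (2 : o))
    (σ : O ≃ₐ[o] O) (hσ : σ ≠ AlgEquiv.refl) :
    ∃ (e : O) (η : o), e * e = algebraMap o O η ∧ σ e = -e ∧
      (∀ x, ∃ a b : o, x = algebraMap o O a + algebraMap o O b * e) ∧
      (∀ a b : o, algebraMap o O a + algebraMap o O b * e = 0 → a = 0 ∧ b = 0) ∧
      ∀ a : o, a * a - η ∉ maximalIdeal o := by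
  obtain ⟨e₀, hspan₀, hind₀⟩ := hO.exists_one_basis
  obtain ⟨z, hz⟩ := h2.exists_right_inv
  have hz' : 2 * algebraMap o O z = 1 := by
    have := congrArg (algebraMap o O) hz
    rwa [map_mul, map_ofNat, map_one] at this
  obtain ⟨n, t, hnt⟩ := hspan₀ (e₀ * e₀)
  -- With z = 1/2, shifting by t/2 completes the square in e₀² = n + te₀.
  obtain ⟨e, he⟩ : ∃ e, e = e₀ - algebraMap o O (z * t) := ⟨_, rfl⟩
  have hspan : ∀ x, ∃ a b : o, x = algebraMap o O a + algebraMap o O b * e := fun x => by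
    obtain ⟨a, b, rfl⟩ := hspan₀ x
    refine ⟨a + b * (z * t), b, ?_⟩
    rw [he, map_add, map_mul]
    ring
  have hind : ∀ a b : o, algebraMap o O a + algebraMap o O b * e = 0 → a = 0 ∧ b = 0 :=
    fun a b h => by
      obtain ⟨ha, rfl⟩ := hind₀ (a - b * (z * t)) b (by
        rw [he] at h
        rw [map_sub, map_mul]
        linear_combination h)
      exact ⟨by simpa using ha, rfl⟩
  have hsq : e * e = algebraMap o O (n + z * t * (z * t)) := by
    rw [he]
    simp only [map_add, map_mul]
    linear_combination hnt - algebraMap o O t * e₀ * hz'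
  refine ⟨e, _, hsq, ?_, hspan, hind, ?_⟩
  · have h1 : (σ e - e) * (σ e + e) = 0 := by
      have := congrArg σ hsq
      rw [map_mul, AlgEquiv.commutes] at this
      linear_combination this - hsq
    rcases mul_eq_zero.1 h1 with h | h
    · refine (hσ (AlgEquiv.ext fun x => ?_)).elim
      obtain ⟨a, b, rfl⟩ := hspan x
      rw [map_add, map_mul, AlgEquiv.commutes, AlgEquiv.commutes, sub_eq_zero.1 h]
      rfl
    · exact eq_neg_of_add_eq_zero_left h
  · intro a ha
    obtain ⟨p, hp⟩ := IsDiscreteValuationRing.exists_irreducible o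
    -- As 𝔓 = pO, both coordinates of an element of 𝔓 are divisible by p. If a² were congruent to
    -- e², one of a ± e would lie in 𝔓 although its coordinate along e is ±1.
    have key : ∀ c d : o, algebraMap o O c + algebraMap o O d * e ∈ maximalIdeal O →
        d ∈ maximalIdeal o := by
      intro c d h
      rw [← hO.map_maximalIdeal, hp.maximalIdeal_eq, Ideal.map_span, Set.image_singleton,
        Ideal.mem_span_singleton'] at h
      obtain ⟨x, hx⟩ := h
      obtain ⟨x1, x2, rfl⟩ := hspan x
      have := (hind (c - x1 * p) (d - x2 * p) (by
        simp only [map_sub, map_mul]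
        linear_combination -hx)).2
      rw [hp.maximalIdeal_eq, Ideal.mem_span_singleton']
      exact ⟨x2, (sub_eq_zero.1 this).symm⟩
    have h1 : (algebraMap o O a - e) * (algebraMap o O a + e) ∈ maximalIdeal O := by
      have := hO.algebraMap_mem ha
      rw [map_sub, ← hsq, map_mul] at this
      convert this using 1
      ring
    rcases (inferInstance : (maximalIdeal O).IsPrime).mem_or_mem h1 with h | h
    · have := key a (-1) (by
        rw [map_neg, map_one]
        convert h using 1
        ring)
      exact (mem_maximalIdeal _).1 this isUnit_one.neg
    · have := key a 1 (by
        rw [map_one]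
        convert h using 1
        ring)
      exact (mem_maximalIdeal _).1 this isUnit_one

/-- The ring homomorphism between the quotients induced by the algebra map. -/
noncomputable def IsUnramifiedQuadratic.levelMap (hO : IsUnramifiedQuadratic o O) (ℓ : ℕ) :
    LevelRing o ℓ →+* LevelRing O ℓ :=
  Ideal.quotientMap (maximalIdeal O ^ ℓ) (algebraMap o O) (by
    rw [← Ideal.map_le_iff_le_comap, Ideal.map_pow, hO.map_maximalIdeal])

/-- Because 𝔓^ℓ = p^ℓ O, the coordinates with respect to 1 and e are well defined modulo p^ℓ, and
the description of O over o descends to the quotients. -/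
theorem IsUnramifiedQuadratic.exists_isInertExtension (hO : IsUnramifiedQuadratic o O)
    (h2 : IsUnit (2 : o)) (σ : O ≃ₐ[o] O) (hσ : σ ≠ AlgEquiv.refl) {ℓ : ℕ}
    [IsLocalRing (LevelRing o ℓ)] :
    ∃ (ε : (LevelRing O ℓ)ˣ) (η : (LevelRing o ℓ)ˣ),
      IsInertExtension (hO.levelMap ℓ) (levelConj σ ℓ) ε η := by
  obtain ⟨e, η, hsq, hσe, hspan, hind, hns⟩ := hO.exists_root h2 σ hσ
  have hη : IsUnit η := not_not.1 fun h => hns 0 (by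
    rw [zero_mul, zero_sub]
    exact neg_mem ((mem_maximalIdeal _).2 h))
  have he : IsUnit e := isUnit_of_mul_isUnit_left (hsq ▸ hη.map (algebraMap o O))
  have hι : ∀ a, hO.levelMap ℓ (Ideal.Quotient.mk _ a) = Ideal.Quotient.mk _ (algebraMap o O a) :=
    fun _ => rfl
  have hc : ∀ x, levelConj σ ℓ (Ideal.Quotient.mk _ x) = Ideal.Quotient.mk _ (σ x) := fun _ => rfl
  refine ⟨(he.map (Ideal.Quotient.mk (maximalIdeal O ^ ℓ))).unit,
    (hη.map (Ideal.Quotient.mk (maximalIdeal o ^ ℓ))).unit, ?_, ?_, ?_, ?_, ?_, ?_⟩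
  · rw [IsUnit.unit_spec, IsUnit.unit_spec, ← map_mul, hsq, hι]
  · rw [IsUnit.unit_spec, hc, hσe, map_neg]
  · intro a
    obtain ⟨a, rfl⟩ := Ideal.Quotient.mk_surjective a
    rw [hι, hc, AlgEquiv.commutes]
  · intro x
    obtain ⟨x, rfl⟩ := Ideal.Quotient.mk_surjective x
    obtain ⟨a, b, rfl⟩ := hspan x
    exact ⟨Ideal.Quotient.mk _ a, Ideal.Quotient.mk _ b, by
      rw [IsUnit.unit_spec, hι, hι, map_add, map_mul]⟩
  · intro a b hab
    obtain ⟨a, rfl⟩ := Ideal.Quotient.mk_surjective a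
    obtain ⟨b, rfl⟩ := Ideal.Quotient.mk_surjective b
    obtain ⟨p, hp⟩ := IsDiscreteValuationRing.exists_irreducible o
    rw [IsUnit.unit_spec, hι, hι, ← map_mul, ← map_add, Ideal.Quotient.eq_zero_iff_mem,
      ← hO.map_maximalIdeal, hp.maximalIdeal_eq, Ideal.map_span, Set.image_singleton,
      Ideal.span_singleton_pow, Ideal.mem_span_singleton'] at hab
    obtain ⟨x, hx⟩ := hab
    obtain ⟨x1, x2, rfl⟩ := hspan x
    obtain ⟨h1, h3⟩ := hind (a - x1 * p ^ ℓ) (b - x2 * p ^ ℓ) (by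
      simp only [map_sub, map_mul, map_pow]
      linear_combination -hx)
    rw [Ideal.Quotient.eq_zero_iff_mem, Ideal.Quotient.eq_zero_iff_mem, hp.maximalIdeal_eq,
      Ideal.span_singleton_pow, Ideal.mem_span_singleton', Ideal.mem_span_singleton']
    exact ⟨⟨x1, (sub_eq_zero.1 h1).symm⟩, ⟨x2, (sub_eq_zero.1 h3).symm⟩⟩
  · intro a ha
    obtain ⟨a, rfl⟩ := Ideal.Quotient.mk_surjective a
    obtain ⟨η', hη'⟩ := hη.map (Ideal.Quotient.mk (maximalIdeal o ^ ℓ))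
    have hu : (hη.map (Ideal.Quotient.mk (maximalIdeal o ^ ℓ))).unit = η' :=
      Units.ext hη'.symm
    rw [hu] at ha
    -- A residual square root a of η⁻¹ would give the residual square root ηa of η.
    refine hns (η * a) ((mk_mem_maximalIdeal_iff (ℓ := ℓ)).1 ?_)
    have h := Ideal.mul_mem_left _ ((η' : LevelRing o ℓ) * η') ha
    have hinv := Units.mul_inv η'
    convert h using 1
    rw [map_sub, map_mul, map_mul, ← hη']
    linear_combination (η' : LevelRing o ℓ) * hinv

end Unramified

theorem mainTheorem7 {o O : Type*}
    [CommRing o] [IsDomain o] [IsDiscreteValuationRing o]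
    [IsAdicComplete (IsLocalRing.maximalIdeal o) o]
    [Finite (IsLocalRing.ResidueField o)]
    (hodd : ringChar (IsLocalRing.ResidueField o) ≠ 2)
    [CommRing O] [IsDomain O] [IsDiscreteValuationRing O] [Algebra o O]
    (hO : IsUnramifiedQuadratic o O)
    (σ : O ≃ₐ[o] O) (hσ : σ ≠ AlgEquiv.refl)
    (q : ℕ) (hq : q = Nat.card (IsLocalRing.ResidueField o))
    (ℓ : ℕ) (hℓ : 1 ≤ ℓ) :
    -- the numbers of real regular and of real non-regular classes coincide
    ((realClasses (GUTwo σ ℓ) ∩ GUTwo.regularClasses σ hℓ).ncard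
        = (realClasses (GLTwo o ℓ) ∩ GLTwo.regularClasses o hℓ).ncard ∧
      (realClasses (GUTwo σ ℓ) \ GUTwo.regularClasses σ hℓ).ncard
        = (realClasses (GLTwo o ℓ) \ GLTwo.regularClasses o hℓ).ncard ∧
      -- the total number of real classes
      (realClasses (GUTwo σ ℓ)).ncard = 1 + q ^ ℓ + 2 * ∑ i ∈ Finset.range ℓ, q ^ i ∧
      (realClasses (GLTwo o ℓ)).ncard = 1 + q ^ ℓ + 2 * ∑ i ∈ Finset.range ℓ, q ^ i) ∧
    -- the number of strongly real classes of the unitary group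
    ((stronglyRealClasses (GUTwo σ ℓ)).ncard
        = (realClasses (GUTwo σ ℓ) ∩ GUTwo.regularClasses σ hℓ).ncard ∧
      (stronglyRealClasses (GUTwo σ ℓ)).ncard = q ^ ℓ + 1) ∧
    -- the numbers of real regular and of real non-regular classes in both groups
    ((realClasses (GLTwo o ℓ) ∩ GLTwo.regularClasses o hℓ).ncard = q ^ ℓ + 1 ∧
      (realClasses (GLTwo o ℓ) \ GLTwo.regularClasses o hℓ).ncard
        = 2 * ∑ i ∈ Finset.range ℓ, q ^ i ∧
      (realClasses (GUTwo σ ℓ) ∩ GUTwo.regularClasses σ hℓ).ncard = q ^ ℓ + 1 ∧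
      (realClasses (GUTwo σ ℓ) \ GUTwo.regularClasses σ hℓ).ncard
        = 2 * ∑ i ∈ Finset.range ℓ, q ^ i) := by
  subst hq
  have := isLocalRing_levelRing (o := o) hℓ
  have := isLocalRing_levelRing (o := O) hℓ
  obtain ⟨p, hp⟩ := IsDiscreteValuationRing.exists_irreducible o
  have H := isOddLevelRing_levelRing (o := o) (ℓ := ℓ) hodd hp.maximalIdeal_eq hℓ
  obtain ⟨ε, η, E⟩ := hO.exists_isInertExtension (ℓ := ℓ) (isUnit_two_of_ringChar_ne_two hodd) σ hσ
  obtain ⟨l1, l2, l3⟩ := ncard_real_classes_GL H (fun g => IsRegularMatrix hℓ g.val)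
    fun g => isRegularMatrix_iff hℓ g.val
  obtain ⟨u1, u2, u3, u4⟩ := E.ncard_classes H (fun g => IsRegularMatrix hℓ g.val.val)
    fun g => isRegularMatrix_iff hℓ g.val.val
  exact ⟨⟨u2.trans l2.symm, u3.trans l3.symm, u1, l1⟩, ⟨u4.trans u2.symm, u4⟩, l2, l3, u2, u3⟩
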